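/- Let $A$ be a finite alphabet, let $A^*$ be the set of finite words in $A$, and let $\zeta : A \to A^*$ be a substitution, extended to $A^*$ by concatenation. Assume that $\zeta$ is expanding, that is, for some $k \ge 1$ one has $|\zeta^k(a)| \ge 2$ for all $a \in A$, where $|u|$ denotes the length of a word $u$. Let $\Sigma_\zeta \subset A^{\mathbb Z}$ be the subshift of all biinfinite words each of whose finite factors is a factor of $\zeta^k(a)$ for some $a \in A$ and some $k \ge 0$, with the Borel $\sigma$-algebra of the product topology ($A$ being discrete) and with the shift operator $(\sigma x)_i = x_{i+1}$. For $w = x_1 \dots x_m \in A^*$ let $\mathrm{Cyl}_w = \{\, y \in \Sigma_\zeta : y_1 = x_1, \dots, y_m = x_m \,\}$, and for $u \in A^*$ let $|u|_w$ be the number of (possibly overlapping) occurrences of $w$ as a factor of $u$. Then there is exactly one family $(\mu_a)_{a \in A}$ of shift-invariant Borel probability measures on $\Sigma_\zeta$ with the following property: there is an exponent $s \ge 1$ such that, for every letter $a \in A$ and every non-empty word $w \in A^*$, $$\mu_a(\mathrm{Cyl}_w) = \lim_{t \to \infty} \frac{|\zeta^{st}(a)|_w}{|\zeta^{st}(a)|},$$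 where in particular the limit on the right exists. (The uniqueness is among all such families, for all exponents $s$; so $\mu_a$ does not depend on the choice of $s$.) -/

import Mathlib

open Filter Topology MeasureTheory

namespace Subst

variable {A : Type*}

/-- The extension of a substitution `ζ : A → A*` to an endomorphism of the free monoid `A*`
(finite words in the letters `A`, realised as lists), by concatenation of the images. -/
def extend (ζ : A → List A) (w : List A) : List A := w.flatMap ζ

/-- The word `ζ^k(a)`. -/
def iter (ζ : A → List A) (k : ℕ) (a : A) : List A := (extend ζ)^[k] [a]

/-- The substitution `ζ^s`, with `a ↦ ζ^s(a)`. -/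
def power (ζ : A → List A) (s : ℕ) : A → List A := fun a => iter ζ s a

/-- `ζ` is expanding if for some `k ≥ 1` all the words `ζ^k(a)` have length at least `2`. -/
def IsExpanding (ζ : A → List A) : Prop :=
  ∃ k : ℕ, 1 ≤ k ∧ ∀ a : A, 2 ≤ (iter ζ k a).length

/-- The language of `ζ`: all factors of the words `ζ^k(a)`, for `a ∈ A` and `k ≥ 0`. -/
def language (ζ : A → List A) : Set (List A) :=
  {w | ∃ (a : A) (k : ℕ), w <:+: iter ζ k a}

/-- The factor `x_i x_{i+1} … x_{i+n-1}` of a biinfinite word `x`. -/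
def factor (x : ℤ → A) (i : ℤ) (n : ℕ) : List A :=
  List.ofFn (fun j : Fin n => x (i + (j : ℕ)))

/-- The substitution subshift `Σ_ζ`: all biinfinite words all of whose finite factors belong to
the language of `ζ`. -/
def subshift (ζ : A → List A) : Set (ℤ → A) :=
  {x | ∀ (i : ℤ) (n : ℕ), factor x i n ∈ language ζ}

/-- The shift operator of `Σ_ζ`, `(σ x)_i = x_{i+1}`. -/
def shift (ζ : A → List A) (x : subshift ζ) : subshift ζ :=
  ⟨fun i => x.1 (i + 1), fun i n => by
    have h := x.2 (i + 1) n
    have e : factor (fun i => x.1 (i + 1)) i n = factor x.1 (i + 1) n := by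
      simp only [factor, add_right_comm]
    rw [e]
    exact h⟩

/-- The cylinder `Cyl_w ⊆ Σ_ζ` of a word `w` of length `m`: all `y ∈ Σ_ζ` with
`y_1 … y_m = w`. -/
def cylinder (ζ : A → List A) (w : List A) : Set (subshift ζ) :=
  {y | factor y.1 1 w.length = w}

/-- The number `|u|_w` of (possibly overlapping) occurrences of `w` as a factor of `u`: the number
of positions `i` such that `w` is a prefix of what remains of `u` after its first `i` letters. -/
def occ [DecidableEq A] (w u : List A) : ℕ :=
  ((Finset.range (u.length + 1)).filter (fun i => w <+: u.drop i)).card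

end Subst

/-! The number of letters `b` in `ζ^t(a)` is an entry of `M ^ t`, where `M` is the incidence matrix,
and the length of `ζ^t(a)` is a row sum. `M` need not be primitive: its powers may oscillate, and
different entries may grow at different rates. Oscillation is removed by passing to a power `P = M ^
s` whose support is a transitive relation (`Matrix.exists_pow_transitive`).

The generating functions of the entries of `P ^ t` are then built, by admitting the intermediate
points of walks one at a time, from the series `C p * X` by sums, products and `f ↦ 1 / (1 - f)`.
The last operation is needed only for `f = 0` or for `f` with positive linear coefficient, where the
renewal theorem applies. So all these series stay in the class `IsTame`: nonnegative coefficients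
that vanish eventually or are asymptotic to a positive multiple of `n ^ d * ρ ^ n`. Ratios of such
coefficients converge if they are at most `1`, which gives the letter frequencies.

For a word `w`, cut `ζ^(s(t+m))(a)` into the blocks `ζ^(sm)(b)`. Occurrences inside blocks are
governed by letter frequencies, and those across block boundaries are negligible for large `m`
because `ζ` is expanding. Hence all word frequencies converge (`Subst.exists_tendsto_frequency`).

The measure is a weak limit of empirical measures along the words `ζ^(st)(a)`. Cylinders are clopen,
so their measures are the frequencies. An invariant measure is determined by its cylinders, and two
exponents `s`, `s'` are compared along multiples of `s * s'`. -/

namespace PowerSeries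

/-! ### The renewal theorem -/

/-- Dominated convergence for truncated convolution sums. -/
theorem tendsto_sum_range_mul_of_dominated {α : Type*} {l : Filter α} {φ : α → ℕ}
    (hφ : Tendsto φ l atTop) {g : ℕ → ℝ} (hg : Summable g) (hg0 : ∀ n, 0 ≤ g n)
    {F : α → ℕ → ℝ} {v : ℕ → ℝ} {K : ℝ} (hF : ∀ x k, k ≤ φ x → |F x k| ≤ K)
    (hv : ∀ k, Tendsto (fun x => F x k) l (𝓝 (v k))) :
    Tendsto (fun x => ∑ k ∈ Finset.range (φ x + 1), g k * F x k) l (𝓝 (∑' k, g k * v k)) := by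
  have key : ∀ x, ∑ k ∈ Finset.range (φ x + 1), g k * F x k =
      ∑' k, if k ≤ φ x then g k * F x k else 0 := by
    intro x
    rw [tsum_eq_sum (s := Finset.range (φ x + 1))]
    · refine Finset.sum_congr rfl fun k hk => ?_
      rw [if_pos (by simpa [Nat.lt_succ_iff] using hk)]
    · intro k hk
      rw [if_neg (by simpa [Nat.lt_succ_iff] using hk)]
  simp_rw [key]
  refine tendsto_tsum_of_dominated_convergence (bound := fun k => g k * |K|)
    (hg.mul_right _) (fun k => ?_) (Eventually.of_forall fun x k => ?_)
  · refine ((hv k).const_mul (g k)).congr' ?_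
    filter_upwards [hφ.eventually_ge_atTop k] with x hx
    rw [if_pos hx]
  · split_ifs with h
    · rw [Real.norm_eq_abs, abs_mul, abs_of_nonneg (hg0 k)]
      exact mul_le_mul_of_nonneg_left ((hF x k h).trans (le_abs_self K)) (hg0 k)
    · simpa using mul_nonneg (hg0 k) (abs_nonneg K)

/-- A function on `ℕ` which is a weighted average of its later values, with positive weight on
the next value, is constant once it is maximal at `0`. -/
theorem eq_of_isMax_of_average {g v : ℕ → ℝ} (hg : HasSum g 1) (hg0 : ∀ n, 0 ≤ g n)
    (hg1 : 0 < g 1) {L : ℝ} (hv : ∀ i, v i ≤ L) {B : ℝ} (hB : ∀ i, |v i| ≤ B) (h0 : v 0 = L)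
    (h : ∀ i, v i = ∑' k, g k * v (i + k)) (i : ℕ) : v i = L := by
  induction i with
  | zero => exact h0
  | succ i ih =>
    refine le_antisymm (hv _) ?_
    have hs : Summable fun k => g k * v (i + k) := by
      refine Summable.of_norm_bounded (g := fun k => g k * B) (hg.summable.mul_right _) fun k => ?_
      rw [Real.norm_eq_abs, abs_mul, abs_of_nonneg (hg0 k)]
      exact mul_le_mul_of_nonneg_left (hB _) (hg0 k)
    have hs2 : HasSum (fun k => g k * (L - v (i + k))) (1 * L - v i) := by
      have := (hg.mul_right L).sub (hs.hasSum)
      rw [← h i] at this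
      simpa only [mul_sub] using this
    -- The nonnegative numbers `g k * (L - v (i + k))` sum to `L - v i = 0`, so the one with `k = 1`
    -- vanishes.
    have h2 := le_hasSum hs2 1 fun k _ => mul_nonneg (hg0 k) (sub_nonneg.2 (hv _))
    rw [ih] at h2
    nlinarith

theorem coeff_mul_range {R : Type*} [CommSemiring R] (f g : R⟦X⟧) (n : ℕ) :
    coeff n (f * g) = ∑ k ∈ Finset.range (n + 1), coeff k g * coeff (n - k) f := by
  rw [mul_comm, coeff_mul, Finset.Nat.sum_antidiagonal_eq_sum_range_succ_mk]

theorem coeff_mul_nonneg {f g : ℝ⟦X⟧} (hf : ∀ n, 0 ≤ coeff n f) (hg : ∀ n, 0 ≤ coeff n g)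
    (n : ℕ) : 0 ≤ coeff n (f * g) := by
  rw [coeff_mul]
  exact Finset.sum_nonneg fun p _ => mul_nonneg (hf _) (hg _)

/-- By `u = 1 + u * f` and the absence of a constant term in `f`, each coefficient of `u` is a
nonnegative combination of earlier ones, plus `1` at the start. -/
theorem coeff_nonneg_of_mul_one_sub {f u : ℝ⟦X⟧} (hf : ∀ n, 0 ≤ coeff n f)
    (hf0 : constantCoeff f = 0) (hu : u * (1 - f) = 1) (n : ℕ) : 0 ≤ coeff n u := by
  have e : u = 1 + u * f := by linear_combination hu
  induction n using Nat.strong_induction_on with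
  | _ n ih =>
    rw [e, map_add, coeff_mul_range]
    refine add_nonneg (by rw [coeff_one]; split_ifs <;> norm_num) (Finset.sum_nonneg ?_)
    intro k hk
    rcases Nat.eq_zero_or_pos k with rfl | hk0
    · simp [hf0]
    · have : k ≤ n := by simpa [Nat.lt_succ_iff] using hk
      exact mul_nonneg (hf k) (ih _ (by omega))

/-- The renewal theorem for a probability distribution on the positive integers which charges `1`
and has exponential tails. -/
theorem exists_tendsto_renewal {g u : ℝ⟦X⟧} (hg0 : ∀ n, 0 ≤ coeff n g)
    (hgc : constantCoeff g = 0) (hg1 : 0 < coeff 1 g) (hg : HasSum (fun n => coeff n g) 1)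
    {y : ℝ} (hy : 1 < y) (hgy : Summable fun n => coeff n g * y ^ n)
    (hu : u * (1 - g) = 1) :
    ∃ c : ℝ, 0 < c ∧ Tendsto (fun n => coeff n u) atTop (𝓝 c) := by
  have hu0 := coeff_nonneg_of_mul_one_sub hg0 hgc hu
  have hug : u = 1 + u * g := by linear_combination hu
  -- the tails of the distribution
  set r : ℝ⟦X⟧ := (mk 1) * (1 - g) with hr
  have hur : u * r = mk 1 := by rw [hr]; linear_combination (mk 1 : ℝ⟦X⟧) * hu
  have hrc : ∀ n, coeff n r = 1 - ∑ k ∈ Finset.range (n + 1), coeff k g := by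
    intro n
    rw [hr, mul_sub, mul_one, map_sub, coeff_mul_range]
    simp
  have hr0 : ∀ n, 0 ≤ coeff n r := by
    intro n
    rw [hrc, sub_nonneg]
    exact sum_le_hasSum _ (fun k _ => hg0 k) hg
  have hr1 : coeff 0 r = 1 := by rw [hrc]; simp [hgc]
  have hrs : Summable fun n => coeff n r := by
    -- The `n`-th tail times `y ^ n` is at most `∑ coeff k g * y ^ k`, as `y ^ n ≤ y ^ k` for `k >
    -- n`.
    refine Summable.of_nonneg_of_le hr0 (f := fun n => (∑' k, coeff k g * y ^ k) * (y⁻¹) ^ n) ?_ ?_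
    · intro n
      rw [inv_pow, ← div_eq_mul_inv, le_div_iff₀ (by positivity), hrc]
      have h1 := (hasSum_nat_add_iff' (n + 1)).2 hg
      have h2 := (hasSum_nat_add_iff' (n + 1)).2 hgy.hasSum
      have h3 : (1 - ∑ k ∈ Finset.range (n + 1), coeff k g) * y ^ n ≤
          (∑' k, coeff k g * y ^ k) - ∑ k ∈ Finset.range (n + 1), coeff k g * y ^ k := by
        refine hasSum_le (fun k => ?_) (h1.mul_right _) h2
        exact mul_le_mul_of_nonneg_left (pow_le_pow_right₀ hy.le (by omega)) (hg0 _)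
      refine h3.trans (sub_le_self _ (Finset.sum_nonneg fun k _ => mul_nonneg (hg0 k) (by positivity)))
    · exact (summable_geometric_of_lt_one (by positivity) (inv_lt_one_of_one_lt₀ hy)).mul_left _
  have hρ : 0 < ∑' n, coeff n r := hrs.tsum_pos hr0 0 (by rw [hr1]; exact one_pos)
  -- All coefficients of `u * r` are `1`, and `coeff n u` is one of the nonnegative summands of the
  -- `n`-th, since `coeff 0 r = 1`.
  have hu1 : ∀ n, coeff n u ≤ 1 := by
    intro n
    have h1 : coeff n (u * r) = 1 := by rw [hur]; simp
    rw [coeff_mul_range] at h1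
    rw [← h1]
    have := Finset.single_le_sum (f := fun k => coeff k r * coeff (n - k) u)
      (s := Finset.range (n + 1)) (fun k _ => mul_nonneg (hr0 _) (hu0 _)) (a := 0) (by simp)
    simpa [hr1] using this
  have hmem : ∀ n, coeff n u ∈ Set.Icc (0 : ℝ) 1 := fun n => ⟨hu0 n, hu1 n⟩
  have hbdd : ∀ n, |coeff n u| ≤ 1 := fun n => by rw [abs_of_nonneg (hu0 n)]; exact hu1 n
  -- the limits of the shifted sequences along an ultrafilter
  have hlim : ∀ U : Ultrafilter ℕ, (U : Filter ℕ) ≤ atTop → ∃ v : ℕ → ℝ,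
      (∀ i, v i ∈ Set.Icc (0 : ℝ) 1) ∧
      (∀ i, Tendsto (fun n => coeff (n - i) u) U (𝓝 (v i))) ∧
      (∀ i, v i = ∑' k, coeff k g * v (i + k)) ∧ ∑' k, coeff k r * v k = 1 := by
    intro U hU
    have : ∀ i, ∃ x ∈ Set.Icc (0 : ℝ) 1, Tendsto (fun n => coeff (n - i) u) U (𝓝 x) := by
      intro i
      exact isCompact_Icc.ultrafilter_le_nhds (U.map fun n => coeff (n - i) u)
        (le_principal_iff.2 (mem_map.2 (univ_mem' fun n => hmem _)))
    choose v hv1 hv2 using this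
    refine ⟨v, hv1, hv2, fun i => ?_, ?_⟩
    · have hφ : Tendsto (fun n : ℕ => n - i) U atTop := (tendsto_sub_atTop_nat i).mono_left hU
      have h1 := tendsto_sum_range_mul_of_dominated hφ hg.summable hg0
        (F := fun n k => coeff (n - i - k) u) (fun n k _ => hbdd _) (v := fun k => v (i + k))
        (fun k => by simpa only [Nat.sub_sub] using hv2 (i + k))
      refine tendsto_nhds_unique (hv2 i) (h1.congr' ?_)
      filter_upwards [hφ.eventually_ge_atTop 1] with n hn
      conv_rhs => rw [hug, map_add, coeff_mul_range, coeff_one, if_neg (by omega), zero_add]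
    · have h1 := tendsto_sum_range_mul_of_dominated (φ := fun n : ℕ => n) hU hrs hr0
        (F := fun n k => coeff (n - k) u) (fun n k _ => hbdd _) hv2
      refine tendsto_nhds_unique h1 (tendsto_const_nhds.congr fun n => ?_)
      rw [← coeff_mul_range, hur]; simp
  have hB1 : IsBoundedUnder (· ≤ ·) atTop fun n => coeff n u :=
    isBoundedUnder_of ⟨1, hu1⟩
  have hB2 : IsBoundedUnder (· ≥ ·) atTop fun n => coeff n u :=
    isBoundedUnder_of ⟨0, hu0⟩
  have hC1 := hB1.isCoboundedUnder_ge
  have hC2 := hB2.isCoboundedUnder_le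
  have hclus : ∀ (U : Ultrafilter ℕ), (U : Filter ℕ) ≤ atTop → ∀ i x,
      Tendsto (fun n => coeff (n - i) u) U (𝓝 x) → MapClusterPt x atTop fun n => coeff n u := by
    intro U hU i x hx
    exact mapClusterPt_iff_ultrafilter.2 ⟨U.map fun n => n - i,
      (tendsto_sub_atTop_nat i).mono_left hU, hx⟩
  have hsup := isGreatest_mapClusterPt_limsup (u := fun n => coeff n u) (f := atTop)
  have hinf := isLeast_mapClusterPt_liminf (u := fun n => coeff n u) (f := atTop)
  -- A limit sequence starting at the limsup or liminf is extremal at `0`, hence constant by the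
  -- averaging identity. The normalization by the tails then leaves only one possible value, so
  -- limsup and liminf agree.
  have hval : ∀ {L : ℝ} {v : ℕ → ℝ}, (∀ i, v i = L) → ∑' k, coeff k r * v k = 1 →
      L = (∑' n, coeff n r)⁻¹ := by
    intro L v hv h
    simp_rw [hv, tsum_mul_right] at h
    exact eq_inv_of_mul_eq_one_right h
  refine ⟨(∑' n, coeff n r)⁻¹, inv_pos.2 hρ, tendsto_of_liminf_eq_limsup ?_ ?_⟩
  · obtain ⟨U, hU, hUt⟩ := mapClusterPt_iff_ultrafilter.1 hinf.1
    obtain ⟨v, hv1, hv2, hv3, hv4⟩ := hlim U hU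
    refine hval (v := v) (fun i => ?_) hv4
    have := eq_of_isMax_of_average hg hg0 hg1 (v := fun i => - v i)
      (fun i => neg_le_neg (hinf.2 (hclus U hU i _ (hv2 i)))) (B := 1)
      (fun i => by rw [abs_neg, abs_of_nonneg (hv1 i).1]; exact (hv1 i).2)
      (congrArg Neg.neg (tendsto_nhds_unique (hv2 0) hUt))
      (fun i => by simp only [mul_neg, tsum_neg, neg_inj]; exact hv3 i) i
    exact neg_inj.1 this
  · obtain ⟨U, hU, hUt⟩ := mapClusterPt_iff_ultrafilter.1 hsup.1
    obtain ⟨v, hv1, hv2, hv3, hv4⟩ := hlim U hU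
    refine hval (v := v) (fun i => ?_) hv4
    exact eq_of_isMax_of_average hg hg0 hg1
      (fun i => hsup.2 (hclus U hU i _ (hv2 i))) (B := 1)
      (fun i => by rw [abs_of_nonneg (hv1 i).1]; exact (hv1 i).2)
      (tendsto_nhds_unique (hv2 0) hUt) hv3 i

/-! ### Polynomial-exponential asymptotics of coefficients -/

/-- The coefficients of `(1 - ρ X) ^ (-(d + 1))`. -/
noncomputable def growth (d : ℕ) (ρ : ℝ) (n : ℕ) : ℝ := ((d + n).choose d : ℝ) * ρ ^ n

theorem growth_pos (d : ℕ) {ρ : ℝ} (hρ : 0 < ρ) (n : ℕ) : 0 < growth d ρ n :=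
  mul_pos (by exact_mod_cast Nat.choose_pos (by omega)) (pow_pos hρ n)

theorem growth_eq_mul_pow (d : ℕ) (ρ : ℝ) (n : ℕ) : growth d ρ n = growth d 1 n * ρ ^ n := by
  simp [growth]

theorem coeff_mk_one_pow (d n : ℕ) :
    coeff n ((mk 1 : ℝ⟦X⟧) ^ (d + 1)) = growth d 1 n := by
  rw [mk_one_pow_eq_mk_choose_add]; simp [growth]

theorem growth_mono (d : ℕ) {k n : ℕ} (h : k ≤ n) : growth d 1 k ≤ growth d 1 n := by
  simp only [growth, one_pow, mul_one]
  exact_mod_cast Nat.choose_le_choose d (by omega)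

theorem summable_growth (d : ℕ) {ρ : ℝ} (h0 : 0 ≤ ρ) (h1 : ρ < 1) : Summable (growth d ρ) := by
  have := summable_choose_mul_geometric_of_norm_lt_one d (r := ρ)
    (by rwa [Real.norm_eq_abs, abs_of_nonneg h0])
  exact this.congr fun n => by rw [growth, add_comm d]

theorem tendsto_growth_div_growth_add (d k : ℕ) :
    Tendsto (fun n => growth d 1 n / growth d 1 (n + k)) atTop (𝓝 1) := by
  induction k with
  | zero =>
    refine tendsto_const_nhds.congr fun n => ?_
    rw [add_zero, div_self (growth_pos d one_pos n).ne']
  | succ k ih =>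
    have h1 : Tendsto (fun n => growth d 1 n / growth d 1 (n + 1)) atTop (𝓝 1) := by
      have h0 : Tendsto (fun n : ℕ => 1 - (d : ℝ) / ((n : ℝ) + (d + 1))) atTop (𝓝 (1 - 0)) :=
        ((tendsto_natCast_atTop_atTop.atTop_add tendsto_const_nhds).const_div_atTop _).const_sub _
      rw [sub_zero] at h0
      refine h0.congr fun n => ?_
      have h := Nat.choose_mul_succ_eq (d + n) d
      rw [show d + n + 1 - d = n + 1 by omega] at h
      have h' : ((d + n).choose d : ℝ) * (d + n + 1) = ((d + n + 1).choose d : ℝ) * (n + 1) := by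
        exact_mod_cast h
      have := growth_pos d one_pos (n + 1)
      have h1 : (1 : ℝ) - (d : ℝ) / ((n : ℝ) + (d + 1)) = (n + 1) / (n + (d + 1)) := by
        have : (n : ℝ) + (d + 1) ≠ 0 := by positivity
        field_simp
        ring
      rw [h1, div_eq_div_iff (by positivity) this.ne']
      simp only [growth, one_pow, mul_one, ← add_assoc]
      linear_combination -h'
    have := ih.mul (h1.comp (tendsto_add_atTop_nat k))
    rw [one_mul] at this
    refine this.congr fun n => ?_
    have := (growth_pos d one_pos (n + k)).ne'
    simp only [Function.comp, add_assoc]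
    field_simp

theorem tendsto_growth_sub_div_growth (d k : ℕ) :
    Tendsto (fun n => growth d 1 (n - k) / growth d 1 n) atTop (𝓝 1) := by
  rw [← tendsto_add_atTop_iff_nat k]
  simpa using tendsto_growth_div_growth_add d k

theorem tendsto_growth_div_growth_of_lt_left {d e : ℕ} (h : d < e) {ρ : ℝ} (hρ : 0 < ρ) :
    Tendsto (fun n => growth d ρ n / growth e ρ n) atTop (𝓝 0) := by
  have h1 : ∀ n, growth d ρ n / growth e ρ n = growth d 1 n / growth e 1 n := by
    intro n
    rw [growth_eq_mul_pow d ρ, growth_eq_mul_pow e ρ, mul_div_mul_right _ _ (pow_pos hρ n).ne']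
  simp_rw [h1]
  induction e, h using Nat.le_induction with
  | base =>
    have : Tendsto (fun n : ℕ => ((d : ℝ) + 1) / ((n : ℝ) + (d + 1))) atTop (𝓝 0) :=
      (tendsto_natCast_atTop_atTop.atTop_add tendsto_const_nhds).const_div_atTop _
    refine this.congr fun n => ?_
    have h := Nat.add_one_mul_choose_eq (d + n) d
    have h' : ((d : ℝ) + n + 1) * (d + n).choose d = ((d + n + 1).choose (d + 1) : ℝ) * (d + 1) := by
      exact_mod_cast h
    have := growth_pos (d + 1) one_pos n
    rw [div_eq_div_iff (by positivity) this.ne']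
    simp only [growth, one_pow, mul_one, show d + 1 + n = d + n + 1 by ring]
    linear_combination -h'
  | succ e he ih =>
    have h2 : ∀ n, growth d ρ n / growth e ρ n = growth d 1 n / growth e 1 n := by
      intro n
      rw [growth_eq_mul_pow d ρ, growth_eq_mul_pow e ρ, mul_div_mul_right _ _ (pow_pos hρ n).ne']
    refine squeeze_zero (fun n => (div_pos (growth_pos _ one_pos _) (growth_pos _ one_pos _)).le)
      (fun n => ?_) (ih h2)
    refine div_le_div_of_nonneg_left (growth_pos _ one_pos _).le (growth_pos _ one_pos _) ?_
    simp only [growth, one_pow, mul_one]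
    have : (e + n).choose e ≤ (e + 1 + n).choose (e + 1) := by
      rw [show e + 1 + n = (e + n) + 1 by ring, Nat.choose_succ_succ]
      omega
    exact_mod_cast this

theorem tendsto_growth_div_growth_of_lt_right (d e : ℕ) {ρ τ : ℝ} (hρ : 0 < ρ) (h : ρ < τ) :
    Tendsto (fun n => growth d ρ n / growth e τ n) atTop (𝓝 0) := by
  have hτ := hρ.trans h
  refine squeeze_zero (fun n => (div_pos (growth_pos _ hρ _) (growth_pos _ hτ _)).le)
    (fun n => ?_) (summable_growth d (div_pos hρ hτ).le ((div_lt_one hτ).2 h)).tendsto_atTop_zero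
  rw [growth_eq_mul_pow d ρ, growth_eq_mul_pow e τ, growth_eq_mul_pow d (ρ / τ), div_pow,
    ← mul_div_assoc]
  refine div_le_div_of_nonneg_left (mul_pos (growth_pos _ one_pos _) (pow_pos hρ n)).le
    (pow_pos hτ n) (le_mul_of_one_le_left (pow_pos hτ n).le ?_)
  simp only [growth, one_pow, mul_one]
  exact_mod_cast Nat.choose_pos (by omega)

theorem growth_trichotomy (d e : ℕ) {ρ τ : ℝ} (hρ : 0 < ρ) (hτ : 0 < τ) :
    (d = e ∧ ρ = τ) ∨ Tendsto (fun n => growth d ρ n / growth e τ n) atTop (𝓝 0) ∨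
      Tendsto (fun n => growth e τ n / growth d ρ n) atTop (𝓝 0) := by
  rcases lt_trichotomy ρ τ with h | rfl | h
  · exact Or.inr (Or.inl (tendsto_growth_div_growth_of_lt_right d e hρ h))
  · rcases lt_trichotomy d e with h | rfl | h
    · exact Or.inr (Or.inl (tendsto_growth_div_growth_of_lt_left h hρ))
    · exact Or.inl ⟨rfl, rfl⟩
    · exact Or.inr (Or.inr (tendsto_growth_div_growth_of_lt_left h hρ))
  · exact Or.inr (Or.inr (tendsto_growth_div_growth_of_lt_right e d hτ h))

/-- The coefficients of `f` are asymptotic to `c` times those of `(1 - ρ X) ^ (-(d + 1))`. -/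
def GrowsLike (f : ℝ⟦X⟧) (d : ℕ) (ρ c : ℝ) : Prop :=
  Tendsto (fun n => coeff n f / growth d ρ n) atTop (𝓝 c)

/-- Since `rescale` is a ring homomorphism, this reduces products at any rate `ρ` to the rate `1`.
-/
theorem growsLike_rescale_inv {f : ℝ⟦X⟧} {d : ℕ} {ρ c : ℝ} (hρ : 0 < ρ) :
    GrowsLike (rescale ρ⁻¹ f) d 1 c ↔ GrowsLike f d ρ c := by
  refine tendsto_congr fun n => ?_
  rw [coeff_rescale, growth_eq_mul_pow d ρ, inv_pow]
  have := pow_pos hρ n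
  have := growth_pos d one_pos n
  field_simp

theorem GrowsLike.exists_bound {f : ℝ⟦X⟧} {d : ℕ} {ρ c : ℝ} (hρ : 0 < ρ) (hf : GrowsLike f d ρ c) :
    ∃ K : ℝ, 0 < K ∧ ∀ n, |coeff n f| ≤ K * growth d ρ n := by
  obtain ⟨K, hK⟩ := hf.norm.bddAbove_range
  refine ⟨max K 1, lt_max_of_lt_right one_pos, fun n => ?_⟩
  have := hK ⟨n, rfl⟩
  simp only [Real.norm_eq_abs, abs_div, abs_of_pos (growth_pos d hρ n)] at this
  rw [div_le_iff₀ (growth_pos d hρ n)] at this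
  exact this.trans (mul_le_mul_of_nonneg_right (le_max_left _ _) (growth_pos d hρ n).le)

/-- A summable factor acts as the constant equal to its sum, because `growth d 1 (n - k) / growth d
1 n` tends to `1` for each fixed `k`. -/
theorem GrowsLike.mul_of_summable {f g : ℝ⟦X⟧} {d : ℕ} {c : ℝ} (hf : GrowsLike f d 1 c)
    (hg0 : ∀ n, 0 ≤ coeff n g) (hg : Summable fun n => coeff n g) :
    GrowsLike (f * g) d 1 (c * ∑' n, coeff n g) := by
  obtain ⟨K, hK, hfK⟩ := hf.exists_bound one_pos
  have := tendsto_sum_range_mul_of_dominated (φ := fun n => n) tendsto_id hg hg0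
    (F := fun n k => coeff (n - k) f / growth d 1 n) (v := fun _ => c) (K := K)
    (fun n k _ => ?_) (fun k => ?_)
  · rw [tsum_mul_right, mul_comm] at this
    refine this.congr fun n => ?_
    rw [coeff_mul_range, Finset.sum_div]
    exact Finset.sum_congr rfl fun k _ => by ring
  · rw [abs_div, abs_of_pos (growth_pos d one_pos n), div_le_iff₀ (growth_pos d one_pos n)]
    exact (hfK _).trans (mul_le_mul_of_nonneg_left (growth_mono d (Nat.sub_le _ _)) hK.le)
  · have h := (hf.comp (tendsto_sub_atTop_nat k)).mul (tendsto_growth_sub_div_growth d k)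
    rw [mul_one] at h
    refine h.congr fun n => ?_
    have := (growth_pos d one_pos (n - k)).ne'
    simp only [Function.comp]
    field_simp

theorem abs_coeff_mul_le {f g F G : ℝ⟦X⟧} (hf : ∀ n, |coeff n f| ≤ coeff n F)
    (hg : ∀ n, |coeff n g| ≤ coeff n G) (n : ℕ) : |coeff n (f * g)| ≤ coeff n (F * G) := by
  rw [coeff_mul, coeff_mul]
  refine (Finset.abs_sum_le_sum_abs _ _).trans (Finset.sum_le_sum fun p _ => ?_)
  rw [abs_mul]
  exact mul_le_mul (hf _) (hg _) (abs_nonneg _) ((abs_nonneg _).trans (hf _))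

theorem growsLike_mk_one_pow (d : ℕ) : GrowsLike ((mk 1 : ℝ⟦X⟧) ^ (d + 1)) d 1 1 := by
  refine tendsto_const_nhds.congr fun n => ?_
  rw [coeff_mk_one_pow, div_self (growth_pos d one_pos n).ne']

theorem GrowsLike.sub {f g : ℝ⟦X⟧} {d : ℕ} {ρ a b : ℝ} (hf : GrowsLike f d ρ a)
    (hg : GrowsLike g d ρ b) : GrowsLike (f - g) d ρ (a - b) :=
  (Tendsto.sub hf hg).congr fun n => by rw [map_sub, sub_div]

theorem GrowsLike.add {f g : ℝ⟦X⟧} {d : ℕ} {ρ a b : ℝ} (hf : GrowsLike f d ρ a)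
    (hg : GrowsLike g d ρ b) : GrowsLike (f + g) d ρ (a + b) :=
  (Tendsto.add hf hg).congr fun n => by rw [map_add, add_div]

theorem GrowsLike.const_mul {f : ℝ⟦X⟧} {d : ℕ} {ρ a : ℝ} (b : ℝ) (hf : GrowsLike f d ρ a) :
    GrowsLike (C b * f) d ρ (b * a) :=
  (Tendsto.const_mul b hf).congr fun n => by rw [coeff_C_mul, mul_div_assoc]

theorem GrowsLike.mul_of_zero {f g : ℝ⟦X⟧} {d e : ℕ} {c : ℝ} (hf : GrowsLike f d 1 0)
    (hg : GrowsLike g e 1 c) : GrowsLike (f * g) (d + e + 1) 1 0 := by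
  obtain ⟨K, hK, hfK⟩ := hf.exists_bound one_pos
  obtain ⟨M, hM, hgM⟩ := hg.exists_bound one_pos
  rw [GrowsLike, Metric.tendsto_atTop]
  intro ε hε
  -- `f` is dominated by `δ * (1 - X) ^ (-(d + 1))` plus a polynomial `P`. Against the bound `M` for
  -- `g`, the first part contributes exactly `δ * M = ε / 2`, and the polynomial part has the lower
  -- degree `e`.
  set δ := ε / (2 * M) with hδ
  have hδ0 : 0 < δ := by positivity
  obtain ⟨N, hN⟩ := Metric.tendsto_atTop.1 hf δ hδ0
  set P : ℝ⟦X⟧ := mk fun n => if n < N then K * growth d 1 n else 0 with hP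
  have hP0 : ∀ n, 0 ≤ coeff n P := by
    intro n
    rw [hP, coeff_mk]
    split_ifs
    · exact mul_nonneg hK.le (growth_pos d one_pos n).le
    · exact le_rfl
  have hPs : Summable fun n => coeff n P := by
    refine summable_of_ne_finset_zero (s := Finset.range N) fun n hn => ?_
    rw [hP, coeff_mk, if_neg (by simpa using hn)]
  have hf2 : ∀ n, |coeff n f| ≤ coeff n (C δ * mk 1 ^ (d + 1) + P) := by
    intro n
    rw [map_add, coeff_C_mul, coeff_mk_one_pow]
    by_cases h : n < N
    · have : coeff n P = K * growth d 1 n := by rw [hP, coeff_mk, if_pos h]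
      rw [this]
      exact (hfK n).trans (le_add_of_nonneg_left (mul_nonneg hδ0.le (growth_pos d one_pos n).le))
    · have h1 := hN n (not_lt.1 h)
      rw [Real.dist_eq, sub_zero, abs_div, abs_of_pos (growth_pos d one_pos n),
        div_lt_iff₀ (growth_pos d one_pos n)] at h1
      exact h1.le.trans (le_add_of_nonneg_right (hP0 n))
  have hg2 : ∀ n, |coeff n g| ≤ coeff n (C M * mk 1 ^ (e + 1)) := by
    intro n
    rw [coeff_C_mul, coeff_mk_one_pow]
    exact hgM n
  have hmul : (C δ * mk 1 ^ (d + 1) + P) * (C M * mk 1 ^ (e + 1)) =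
      C (δ * M) * mk 1 ^ (d + e + 1 + 1) + C M * (mk 1 ^ (e + 1) * P) := by
    rw [map_mul]; ring
  have h1 := ((growsLike_mk_one_pow e).mul_of_summable hP0 hPs).const_mul M
  have h2 : Tendsto (fun n => coeff n (C M * (mk 1 ^ (e + 1) * P)) / growth (d + e + 1) 1 n)
      atTop (𝓝 0) := by
    have := Tendsto.mul h1 (tendsto_growth_div_growth_of_lt_left (show e < d + e + 1 by omega)
      one_pos)
    rw [mul_zero] at this
    refine this.congr fun n => ?_
    have := (growth_pos e one_pos n).ne'
    field_simp
  obtain ⟨N', hN'⟩ := Metric.tendsto_atTop.1 h2 (ε / 2) (by positivity)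
  refine ⟨N', fun n hn => ?_⟩
  have h3 := hN' n hn
  have h4 := abs_coeff_mul_le hf2 hg2 n
  have hpos := growth_pos (d + e + 1) one_pos n
  rw [Real.dist_eq, sub_zero] at h3 ⊢
  rw [hmul, map_add, coeff_C_mul, coeff_mk_one_pow] at h4
  rw [abs_div, abs_of_pos hpos, div_lt_iff₀ hpos]
  have h5 := (le_abs_self _).trans_lt h3
  rw [div_lt_iff₀ hpos] at h5
  have h6 : δ * M = ε / 2 := by rw [hδ]; field_simp
  rw [h6] at h4
  linarith

/-- Each factor is a multiple of a power of `1 / (1 - X)` plus a remainder of smaller order. The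
main parts multiply exactly, and `mul_of_zero` absorbs the cross terms. -/
theorem GrowsLike.mul {f g : ℝ⟦X⟧} {d e : ℕ} {a b : ℝ} (hf : GrowsLike f d 1 a)
    (hg : GrowsLike g e 1 b) : GrowsLike (f * g) (d + e + 1) 1 (a * b) := by
  have hf' : GrowsLike (f - C a * mk 1 ^ (d + 1)) d 1 0 := by
    simpa using hf.sub ((growsLike_mk_one_pow d).const_mul a)
  have hg' : GrowsLike (g - C b * mk 1 ^ (e + 1)) e 1 0 := by
    simpa using hg.sub ((growsLike_mk_one_pow e).const_mul b)
  have h1 := hf'.mul_of_zero hg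
  have h2 := (hg'.mul_of_zero (growsLike_mk_one_pow d)).const_mul a
  rw [add_comm e d] at h2
  have h3 := (growsLike_mk_one_pow (d + e + 1)).const_mul (a * b)
  have h4 := (h1.add h2).add h3
  rw [map_mul] at h4
  convert h4 using 1
  · ring
  · ring

/-! ### Tame series and their closure properties -/

/-- Power series with nonnegative coefficients which either is a polynomial or has coefficients
with a polynomial-exponential asymptotic. -/
def IsTame (f : ℝ⟦X⟧) : Prop :=
  (∀ n, 0 ≤ coeff n f) ∧ ((∀ᶠ n in atTop, coeff n f = 0) ∨
    ∃ (d : ℕ) (ρ c : ℝ), 0 < ρ ∧ 0 < c ∧ GrowsLike f d ρ c)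

theorem GrowsLike.add_of_tendsto_zero {f g : ℝ⟦X⟧} {d e : ℕ} {ρ τ a b : ℝ} (hτ : 0 < τ)
    (hf : GrowsLike f d ρ a) (hg : GrowsLike g e τ b)
    (h : Tendsto (fun n => growth e τ n / growth d ρ n) atTop (𝓝 0)) :
    GrowsLike (f + g) d ρ a := by
  have := Tendsto.add hf (Tendsto.mul hg h)
  rw [mul_zero, add_zero] at this
  refine this.congr fun n => ?_
  have := (growth_pos e hτ n).ne'
  rw [map_add]
  field_simp

theorem GrowsLike.add_of_eventually_zero {f g : ℝ⟦X⟧} {d : ℕ} {ρ a : ℝ}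
    (hf : GrowsLike f d ρ a) (hg : ∀ᶠ n in atTop, coeff n g = 0) : GrowsLike (f + g) d ρ a := by
  refine Tendsto.congr' ?_ hf
  filter_upwards [hg] with n hn
  rw [map_add, hn, add_zero]

theorem IsTame.add {f g : ℝ⟦X⟧} (hf : IsTame f) (hg : IsTame g) : IsTame (f + g) := by
  refine ⟨fun n => by rw [map_add]; exact add_nonneg (hf.1 n) (hg.1 n), ?_⟩
  rcases hf.2 with h0 | ⟨d, ρ, a, hρ, ha, h⟩ <;> rcases hg.2 with h0' | ⟨e, τ, b, hτ, hb, h'⟩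
  · left
    filter_upwards [h0, h0'] with n h1 h2
    rw [map_add, h1, h2, add_zero]
  · right
    exact ⟨e, τ, b, hτ, hb, by rw [add_comm]; exact h'.add_of_eventually_zero h0⟩
  · right
    exact ⟨d, ρ, a, hρ, ha, h.add_of_eventually_zero h0'⟩
  · right
    rcases growth_trichotomy d e hρ hτ with ⟨rfl, rfl⟩ | h1 | h1
    · exact ⟨d, ρ, a + b, hρ, add_pos ha hb, h.add h'⟩
    · exact ⟨e, τ, b, hτ, hb, by rw [add_comm]; exact h'.add_of_tendsto_zero hρ h h1⟩
    · exact ⟨d, ρ, a, hρ, ha, h.add_of_tendsto_zero hτ h' h1⟩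

/-- The constant is multiplied by the value of `g` at `ρ⁻¹`, which is positive because `g` is
nonzero with nonnegative coefficients. -/
theorem GrowsLike.exists_mul {f g : ℝ⟦X⟧} {d : ℕ} {ρ c : ℝ} (hρ : 0 < ρ) (hc : 0 < c)
    (hf : GrowsLike f d ρ c) (hg0 : ∀ n, 0 ≤ coeff n g) (hg : g ≠ 0)
    (hgs : Summable fun n => coeff n (rescale ρ⁻¹ g)) :
    ∃ c', 0 < c' ∧ GrowsLike (f * g) d ρ c' := by
  have h0 : ∀ n, 0 ≤ coeff n (rescale ρ⁻¹ g) := fun n => by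
    rw [coeff_rescale]; exact mul_nonneg (by positivity) (hg0 n)
  have h1 := ((growsLike_rescale_inv hρ).2 hf).mul_of_summable h0 hgs
  rw [← map_mul, growsLike_rescale_inv hρ] at h1
  refine ⟨_, mul_pos hc ?_, h1⟩
  obtain ⟨n, hn⟩ : ∃ n, coeff n g ≠ 0 := by
    by_contra! h
    exact hg (ext h)
  refine hgs.tsum_pos h0 n ?_
  rw [coeff_rescale]
  exact mul_pos (by positivity) ((hg0 n).lt_of_ne' hn)

theorem summable_of_eventually_zero {g : ℝ⟦X⟧} (h : ∀ᶠ n in atTop, coeff n g = 0) (r : ℝ) :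
    Summable fun n => coeff n (rescale r g) := by
  obtain ⟨N, hN⟩ := eventually_atTop.1 h
  refine summable_of_ne_finset_zero (s := Finset.range N) fun n hn => ?_
  rw [coeff_rescale, hN n (by simpa using hn), mul_zero]

theorem GrowsLike.summable {g : ℝ⟦X⟧} {d : ℕ} {ρ c r : ℝ} (hρ : 0 < ρ) (hg : GrowsLike g d ρ c)
    (hr : 0 ≤ r) (h : r * ρ < 1) : Summable fun n => coeff n (rescale r g) := by
  obtain ⟨K, hK, hgK⟩ := hg.exists_bound hρ
  refine Summable.of_norm_bounded (g := fun n => K * growth d (r * ρ) n)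
    ((summable_growth d (mul_nonneg hr hρ.le) h).mul_left _) fun n => ?_
  rw [coeff_rescale, Real.norm_eq_abs, abs_mul, abs_of_nonneg (pow_nonneg hr n)]
  refine (mul_le_mul_of_nonneg_left (hgK n) (pow_nonneg hr n)).trans_eq ?_
  rw [growth_eq_mul_pow d ρ, growth_eq_mul_pow d (r * ρ), mul_pow]
  ring

theorem isTame_zero : IsTame 0 := ⟨fun n => by simp, Or.inl (by simp)⟩

/-- The factor with the larger rate imposes its growth. At equal rates the orders of the poles add
up, whence the degree `d + e + 1`. -/
theorem IsTame.mul {f g : ℝ⟦X⟧} (hf : IsTame f) (hg : IsTame g) : IsTame (f * g) := by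
  rcases eq_or_ne f 0 with rfl | hf0
  · rw [zero_mul]; exact isTame_zero
  rcases eq_or_ne g 0 with rfl | hg0
  · rw [mul_zero]; exact isTame_zero
  refine ⟨coeff_mul_nonneg hf.1 hg.1, ?_⟩
  rcases hf.2 with h0 | ⟨d, ρ, a, hρ, ha, h⟩ <;> rcases hg.2 with h0' | ⟨e, τ, b, hτ, hb, h'⟩
  · left
    obtain ⟨N, hN⟩ := eventually_atTop.1 h0
    obtain ⟨M, hM⟩ := eventually_atTop.1 h0'
    filter_upwards [eventually_ge_atTop (N + M)] with n hn
    rw [coeff_mul]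
    refine Finset.sum_eq_zero fun p hp => ?_
    have hp' := Finset.HasAntidiagonal.mem_antidiagonal.1 hp
    rcases le_or_gt N p.1 with h1 | h1
    · rw [hN _ h1, zero_mul]
    · rw [hM _ (by omega), mul_zero]
  · right
    obtain ⟨c, hc, h1⟩ := h'.exists_mul hτ hb hf.1 hf0 (summable_of_eventually_zero h0 _)
    exact ⟨e, τ, c, hτ, hc, by rwa [mul_comm]⟩
  · right
    obtain ⟨c, hc, h1⟩ := h.exists_mul hρ ha hg.1 hg0 (summable_of_eventually_zero h0' _)
    exact ⟨d, ρ, c, hρ, hc, h1⟩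
  · right
    rcases lt_trichotomy ρ τ with h1 | rfl | h1
    · obtain ⟨c, hc, h1⟩ := h'.exists_mul hτ hb hf.1 hf0
        (h.summable hρ (inv_pos.2 hτ).le (by rwa [inv_mul_lt_one₀ hτ]))
      exact ⟨e, τ, c, hτ, hc, by rwa [mul_comm]⟩
    · refine ⟨d + e + 1, ρ, a * b, hρ, mul_pos ha hb, ?_⟩
      rw [← growsLike_rescale_inv hρ, map_mul]
      exact ((growsLike_rescale_inv hρ).2 h).mul ((growsLike_rescale_inv hρ).2 h')
    · obtain ⟨c, hc, h1⟩ := h.exists_mul hρ ha hg.1 hg0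
        (h'.summable hτ (inv_pos.2 hρ).le (by rwa [inv_mul_lt_one₀ hρ]))
      exact ⟨d, ρ, c, hρ, hc, h1⟩

/-- The ratio of the coefficients of two tame series converges, if it is at most `1`. -/
theorem IsTame.exists_tendsto_div {f g : ℝ⟦X⟧} (hf : IsTame f) (hg : IsTame g)
    (hfg : ∀ n, coeff n f ≤ coeff n g) :
    ∃ c, Tendsto (fun n => coeff n f / coeff n g) atTop (𝓝 c) := by
  rcases hf.2 with h0 | ⟨d, ρ, a, hρ, ha, h⟩
  · refine ⟨0, tendsto_const_nhds.congr' ?_⟩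
    filter_upwards [h0] with n hn
    rw [hn, zero_div]
  rcases hg.2 with h0 | ⟨e, τ, b, hτ, hb, h'⟩
  · refine ⟨0, tendsto_const_nhds.congr' ?_⟩
    filter_upwards [h0] with n hn
    rw [hn, div_zero]
  have hkey : ∀ {q : ℝ}, Tendsto (fun n => growth d ρ n / growth e τ n) atTop (𝓝 q) →
      ∃ c, Tendsto (fun n => coeff n f / coeff n g) atTop (𝓝 c) := by
    intro q hq
    refine ⟨_, ((Tendsto.mul h hq).div h' hb.ne').congr fun n => ?_⟩
    have h1 := (growth_pos d hρ n).ne'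
    have h2 := (growth_pos e hτ n).ne'
    simp only [Pi.div_apply]
    rw [div_mul_div_cancel₀ h1, div_div_div_cancel_right₀ h2]
  rcases growth_trichotomy d e hρ hτ with ⟨rfl, rfl⟩ | h1 | h1
  · exact hkey (tendsto_const_nhds.congr fun n => (div_self (growth_pos d hρ n).ne').symm)
  · exact hkey h1
  -- If `f` outgrew `g`, then `coeff n f ≤ coeff n g` would force `a ≤ 0`.
  · exfalso
    have h2 := Tendsto.mul h' h1
    rw [mul_zero] at h2
    refine absurd (le_of_tendsto_of_tendsto' h h2 fun n => ?_) (not_le.2 ha)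
    rw [div_mul_div_cancel₀ (growth_pos e hτ n).ne']
    exact div_le_div_of_nonneg_right (hfg n) (growth_pos d hρ n).le

/-- This places a solution of `f(x) = 1` strictly inside the region of convergence. For a
polynomial, the linear term alone is `2` at `R`; otherwise `R = ρ⁻¹`, where the series diverges
because `growth d ρ n ≥ ρ ^ n` keeps its terms away from `0`. -/
theorem IsTame.exists_radius {f : ℝ⟦X⟧} (hf : IsTame f) (h0 : constantCoeff f = 0)
    (h1 : 0 < coeff 1 f) : ∃ R : ℝ, 0 < R ∧
      (∀ x, 0 ≤ x → x < R → Summable fun n => coeff n f * x ^ n) ∧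
      ∃ K, 1 < ∑ n ∈ Finset.range K, coeff n f * R ^ n := by
  rcases hf.2 with h | ⟨d, ρ, a, hρ, ha, h⟩
  · refine ⟨2 / coeff 1 f, by positivity, fun x _ _ => ?_, 2, ?_⟩
    · exact (summable_of_eventually_zero h x).congr fun n => by rw [coeff_rescale, mul_comm]
    · rw [Finset.sum_range_succ, Finset.sum_range_one, coeff_zero_eq_constantCoeff_apply, h0,
        pow_one, mul_div_cancel₀ _ h1.ne']
      norm_num
  · refine ⟨ρ⁻¹, inv_pos.2 hρ, fun x hx hxR => ?_, ?_⟩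
    · refine (h.summable hρ hx ?_).congr fun n => by rw [coeff_rescale, mul_comm]
      rwa [← lt_div_iff₀ hρ, one_div]
    · have hns : ¬ Summable fun n => coeff n f * ρ⁻¹ ^ n := by
        intro hs
        refine absurd (le_of_tendsto_of_tendsto h hs.tendsto_atTop_zero
          (Eventually.of_forall fun n => ?_)) (not_le.2 ha)
        change coeff n f / growth d ρ n ≤ coeff n f * ρ⁻¹ ^ n
        rw [inv_pow, ← div_eq_mul_inv]
        refine div_le_div_of_nonneg_left (hf.1 n) (pow_pos hρ n)
          (le_mul_of_one_le_left (pow_pos hρ n).le ?_)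
        exact_mod_cast Nat.choose_pos (by omega)
      have := (not_summable_iff_tendsto_nat_atTop_of_nonneg
        (fun n => mul_nonneg (hf.1 n) (by positivity))).1 hns
      exact (this.eventually_gt_atTop 1).exists

/-- With `f(x₀) = 1`, the numbers `coeff n f * x₀ ^ n` form a probability distribution, and the
renewal theorem says that `coeff n u * x₀ ^ n` converges to a positive limit: `u` has degree `0` and
rate `x₀⁻¹`. -/
theorem IsTame.of_mul_one_sub {f u : ℝ⟦X⟧} (hf : IsTame f) (h0 : constantCoeff f = 0)
    (h1 : 0 < coeff 1 f) (hu : u * (1 - f) = 1) : IsTame u := by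
  obtain ⟨R, hR, hs, K, hK⟩ := hf.exists_radius h0 h1
  obtain ⟨x₁, hx₁K, hx₁0, hx₁R⟩ : ∃ x₁, 1 < ∑ n ∈ Finset.range K, coeff n f * x₁ ^ n ∧
      0 < x₁ ∧ x₁ < R := by
    have hc : ContinuousAt (fun x : ℝ => ∑ n ∈ Finset.range K, coeff n f * x ^ n) R := by fun_prop
    have h2 := (hc.eventually (lt_mem_nhds hK)).filter_mono (nhdsWithin_le_nhds (s := Set.Iio R))
    have h3 : ∀ᶠ x in 𝓝[<] R, 0 < x := (lt_mem_nhds hR).filter_mono nhdsWithin_le_nhds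
    exact (h2.and (h3.and self_mem_nhdsWithin)).exists
  have hcont : ContinuousOn (fun x : ℝ => ∑' n, coeff n f * x ^ n) (Set.Icc 0 x₁) := by
    refine continuousOn_tsum (fun n => by fun_prop) (hs x₁ hx₁0.le hx₁R) fun n x hx => ?_
    rw [Real.norm_eq_abs, abs_of_nonneg (mul_nonneg (hf.1 n) (pow_nonneg hx.1 n))]
    exact mul_le_mul_of_nonneg_left (pow_le_pow_left₀ hx.1 hx.2 n) (hf.1 n)
  have hF0 : ∑' n, coeff n f * (0 : ℝ) ^ n = 0 := by
    rw [tsum_eq_single 0 fun n hn => by rw [zero_pow hn, mul_zero],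
      coeff_zero_eq_constantCoeff_apply, h0, zero_mul]
  have hF1 : 1 ≤ ∑' n, coeff n f * x₁ ^ n :=
    hx₁K.le.trans ((hs x₁ hx₁0.le hx₁R).sum_le_tsum _
      fun n _ => mul_nonneg (hf.1 n) (pow_nonneg hx₁0.le n))
  obtain ⟨x₀, ⟨hx₀0, hx₀1⟩, hx₀⟩ := intermediate_value_Icc hx₁0.le hcont
    (show (1 : ℝ) ∈ Set.Icc _ _ from ⟨by simp only [hF0]; exact zero_le_one, hF1⟩)
  simp only at hx₀
  have hpos : 0 < x₀ := by
    refine hx₀0.lt_of_ne ?_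
    rintro rfl
    rw [hF0] at hx₀
    exact zero_ne_one hx₀
  -- Convergence at a point beyond `x₀` provides the exponential tails, with `y = x₂ / x₀`.
  obtain ⟨x₂, h02, h2R⟩ := exists_between (hx₀1.trans_lt hx₁R)
  obtain ⟨c, hc, hlim⟩ := exists_tendsto_renewal (g := rescale x₀ f) (u := rescale x₀ u)
    (y := x₂ / x₀)
    (fun n => by rw [coeff_rescale]; exact mul_nonneg (pow_nonneg hx₀0 n) (hf.1 n))
    (by rw [← coeff_zero_eq_constantCoeff_apply, coeff_rescale, coeff_zero_eq_constantCoeff_apply,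
      h0, mul_zero])
    (by rw [coeff_rescale, pow_one]; exact mul_pos hpos h1)
    (by
      simp_rw [coeff_rescale, mul_comm (x₀ ^ _)]
      rw [← hx₀]
      exact (hs x₀ hx₀0 (h02.trans h2R)).hasSum)
    ((one_lt_div hpos).2 h02)
    ((hs x₂ (hx₀0.trans h02.le) h2R).congr fun n => by
      have := pow_pos hpos n
      rw [coeff_rescale, div_pow]; field_simp)
    (by rw [← map_one (rescale x₀), ← map_sub, ← map_mul, hu])
  refine ⟨coeff_nonneg_of_mul_one_sub hf.1 h0 hu, Or.inr ⟨0, x₀⁻¹, c, inv_pos.2 hpos, hc, ?_⟩⟩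
  refine hlim.congr fun n => ?_
  rw [coeff_rescale, growth, inv_pow]
  simp [mul_comm]

theorem IsTame.sum {ι : Type*} {s : Finset ι} {f : ι → ℝ⟦X⟧} (h : ∀ i ∈ s, IsTame (f i)) :
    IsTame (∑ i ∈ s, f i) :=
  Finset.sum_induction f IsTame (fun _ _ => IsTame.add) isTame_zero h

theorem isTame_C_mul_X {c : ℝ} (hc : 0 ≤ c) : IsTame (C c * X) := by
  refine ⟨fun n => ?_, Or.inl ?_⟩
  · rw [coeff_C_mul, coeff_X]
    split_ifs <;> simp [hc]
  · filter_upwards [eventually_gt_atTop 1] with n hn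
    rw [coeff_C_mul, coeff_X, if_neg (by omega), mul_zero]

theorem isTame_one : IsTame 1 := by
  refine ⟨fun n => ?_, Or.inl ?_⟩
  · rw [coeff_one]
    split_ifs <;> simp
  · filter_upwards [eventually_gt_atTop 0] with n hn
    rw [coeff_one, if_neg (by omega)]

end PowerSeries

/-! ### Powers of nonnegative matrices -/

namespace Matrix

open PowerSeries

variable {ι : Type*} [DecidableEq ι]

/-- The generating functions of the walks with intermediate points in a given finite set, for a
nonnegative matrix with transitive support, are tame. -/
theorem exists_isTame_walks (P : Matrix ι ι ℝ) (hP : ∀ i j, 0 ≤ P i j)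
    (htrans : ∀ i j k, 0 < P i j → 0 < P j k → 0 < P i k) (S : Finset ι) :
    ∃ G : ι → ι → ℝ⟦X⟧, ∀ i j, IsTame (G i j) ∧ (G i j ≠ 0 → 0 < P i j) ∧
      G i j = C (P i j) * X + ∑ k ∈ S, C (P i k) * X * G k j := by
  induction S using Finset.induction_on with
  | empty =>
    refine ⟨fun i j => C (P i j) * X, fun i j => ⟨isTame_C_mul_X (hP i j), fun h => ?_, by simp⟩⟩
    refine (hP i j).lt_of_ne ?_
    intro h'
    exact h (by simp only [← h', map_zero, zero_mul])
  | insert c S hc ih =>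
    obtain ⟨G, hG⟩ := ih
    have h0 : constantCoeff (G c c) = 0 := by
      rw [(hG c c).2.2]
      simp
    set u : ℝ⟦X⟧ := (1 - G c c)⁻¹ with hu_def
    have hu : u * (1 - G c c) = 1 := by
      rw [mul_comm]
      exact PowerSeries.mul_inv_cancel _ (by simp [h0])
    -- Transitivity enters here: a nonzero `G c c` forces `P c c > 0`, hence a positive linear
    -- coefficient, which is the aperiodicity that the renewal theorem needs.
    have hut : IsTame u := by
      by_cases hz : G c c = 0
      · rw [hz, sub_zero, mul_one] at hu
        rw [hu]
        exact isTame_one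
      · refine (hG c c).1.of_mul_one_sub h0 ?_ hu
        rw [(hG c c).2.2, map_add, map_sum]
        refine add_pos_of_pos_of_nonneg ?_ (Finset.sum_nonneg fun k _ => ?_)
        · simpa using (hG c c).2.1 hz
        · exact coeff_mul_nonneg (isTame_C_mul_X (hP c k)).1 (hG k c).1.1 1
    -- A walk either avoids `c` as an intermediate point or splits at its first and last visits to
    -- `c`; `u` counts the sequences of loops at `c` in between.
    refine ⟨fun i j => G i j + G i c * u * G c j, fun i j => ⟨?_, ?_, ?_⟩⟩
    · exact (hG i j).1.add (((hG i c).1.mul hut).mul (hG c j).1)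
    · intro h
      by_cases hij : G i j = 0
      · simp only [hij, zero_add] at h
        exact htrans i c j ((hG i c).2.1 (left_ne_zero_of_mul (left_ne_zero_of_mul h)))
          ((hG c j).2.1 (right_ne_zero_of_mul h))
      · exact (hG i j).2.1 hij
    · rw [Finset.sum_insert hc]
      have e1 : ∑ k ∈ S, C (P i k) * X * (G k j + G k c * u * G c j) =
          ∑ k ∈ S, C (P i k) * X * G k j + (∑ k ∈ S, C (P i k) * X * G k c) * (u * G c j) := by
        rw [Finset.sum_mul, ← Finset.sum_add_distrib]
        exact Finset.sum_congr rfl fun k _ => by ring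
      have e2 := (hG i j).2.2
      have e3 := (hG i c).2.2
      rw [e1]
      linear_combination e2 + (u * G c j) * e3 + (C (P i c) * X * G c j) * hu

/-- The powers of a nonnegative matrix with transitive support have convergent normalized rows. -/
theorem exists_tendsto_pow_div_sum [Fintype ι] (P : Matrix ι ι ℝ) (hP : ∀ i j, 0 ≤ P i j)
    (htrans : ∀ i j k, 0 < P i j → 0 < P j k → 0 < P i k) (i j : ι) :
    ∃ c, Tendsto (fun t : ℕ => (P ^ t) i j / ∑ k, (P ^ t) i k) atTop (𝓝 c) := by
  obtain ⟨G, hG⟩ := exists_isTame_walks P hP htrans Finset.univ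
  have hpow : ∀ (t : ℕ) i j, coeff (t + 1) (G i j) = (P ^ (t + 1)) i j := by
    intro t
    induction t with
    | zero =>
      intro i j
      have h0 : ∀ k, coeff 0 (G k j) = 0 := fun k => by
        rw [(hG k j).2.2]; simp
      rw [(hG i j).2.2, map_add, map_sum]
      simp only [zero_add, coeff_C_mul, mul_assoc, coeff_one_X, mul_one, pow_one]
      rw [Finset.sum_eq_zero fun k _ => ?_, add_zero]
      rw [show (1 : ℕ) = 0 + 1 from rfl, coeff_succ_X_mul, h0, mul_zero]
    | succ t ih =>
      intro i j
      rw [(hG i j).2.2, map_add, map_sum, pow_succ', Matrix.mul_apply]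
      simp only [coeff_C_mul, mul_assoc, coeff_succ_X_mul, ih]
      rw [coeff_X, if_neg (by omega), mul_zero, zero_add]
  obtain ⟨c, hc⟩ := (hG i j).1.exists_tendsto_div
    (IsTame.sum (s := Finset.univ) (f := fun k => G i k) fun k _ => (hG i k).1) (fun n => by
      rw [map_sum]
      exact Finset.single_le_sum (f := fun k => coeff n (G i k)) (fun k _ => (hG i k).1.1 n)
        (Finset.mem_univ j))
  refine ⟨c, (tendsto_add_atTop_iff_nat 1).1 (((tendsto_add_atTop_iff_nat 1).2 hc).congr
    fun t => ?_)⟩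
  rw [map_sum]
  simp_rw [hpow]

/-- Some power of a nonnegative matrix has transitive support. -/
theorem exists_pow_transitive [Fintype ι] (M : Matrix ι ι ℝ) (hM : ∀ i j, 0 ≤ M i j) :
    ∃ s : ℕ, 1 ≤ s ∧ ∀ i j k, 0 < (M ^ s) i j → 0 < (M ^ s) j k → 0 < (M ^ s) i k := by
  classical
  have hpow : ∀ s i j, 0 ≤ (M ^ s) i j := by
    intro s
    induction s with
    | zero => intro i j; rw [pow_zero, Matrix.one_apply]; split_ifs <;> norm_num
    | succ s ih =>
      intro i j
      rw [pow_succ, Matrix.mul_apply]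
      exact Finset.sum_nonneg fun k _ => mul_nonneg (ih _ _) (hM _ _)
  have hadd : ∀ s t i j, 0 < (M ^ (s + t)) i j ↔ ∃ k, 0 < (M ^ s) i k ∧ 0 < (M ^ t) k j := by
    intro s t i j
    rw [pow_add, Matrix.mul_apply,
      Finset.sum_pos_iff_of_nonneg fun k _ => mul_nonneg (hpow _ _ _) (hpow _ _ _)]
    constructor
    · rintro ⟨k, -, hk⟩
      exact ⟨k, (pos_iff_pos_of_mul_pos hk |>.2 (pos_of_mul_pos_right hk (hpow _ _ _))),
        pos_of_mul_pos_right hk (hpow _ _ _)⟩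
    · rintro ⟨k, h1, h2⟩
      exact ⟨k, Finset.mem_univ _, mul_pos h1 h2⟩
  -- There are finitely many possible supports, and the support of `M ^ s` determines that of `M ^
  -- (s + t)`. So the supports are periodic from some `m` on.
  let B : ℕ → Set (ι × ι) := fun s => {p | 0 < (M ^ s) p.1 p.2}
  have hBadd : ∀ {s s'}, B s = B s' → ∀ t, B (s + t) = B (s' + t) := by
    intro s s' h t
    ext ⟨i, j⟩
    have h' : ∀ i k, 0 < (M ^ s) i k ↔ 0 < (M ^ s') i k := fun i k => by
      simpa [B] using Set.ext_iff.1 h (i, k)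
    simp only [B, Set.mem_ofPred_eq, hadd, h']
  obtain ⟨m, n, hmn, hB⟩ := Finite.exists_ne_map_eq_of_infinite B
  wlog hlt : m < n generalizing m n
  · exact this n m hmn.symm hB.symm (lt_of_le_of_ne (not_lt.1 hlt) hmn.symm)
  obtain ⟨p, rfl⟩ := Nat.exists_eq_add_of_lt hlt
  have hper : ∀ q t, m ≤ t → B (t + q * (p + 1)) = B t := by
    intro q t ht
    obtain ⟨r, rfl⟩ := Nat.exists_eq_add_of_le ht
    induction q with
    | zero => simp
    | succ q ih =>
      rw [show m + r + (q + 1) * (p + 1) = m + p + 1 + (r + q * (p + 1)) by ring,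
        ← hBadd hB, ← add_assoc, ih]
  -- This exponent `s` is a multiple of the period and at least `m`, so `M ^ (s + s)` and `M ^ s`
  -- have the same support.
  refine ⟨(m + 1) * (p + 1), Nat.mul_pos (by omega) (by omega), fun i j k h1 h2 => ?_⟩
  have h3 : (i, k) ∈ B ((m + 1) * (p + 1) + (m + 1) * (p + 1)) := (hadd _ _ _ _).2 ⟨j, h1, h2⟩
  rw [hper (m + 1) _ (by nlinarith)] at h3
  exact h3

end Matrix

/-! ### Iterates of a substitution and their lengths -/

namespace Subst

variable {A : Type*}

theorem extend_append (ζ : A → List A) (u v : List A) :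
    extend ζ (u ++ v) = extend ζ u ++ extend ζ v := by
  simp [extend]

theorem iterate_extend_append (ζ : A → List A) (k : ℕ) (u v : List A) :
    (extend ζ)^[k] (u ++ v) = (extend ζ)^[k] u ++ (extend ζ)^[k] v := by
  induction k generalizing u v with
  | zero => rfl
  | succ k ih => simp only [Function.iterate_succ_apply, extend_append, ih]

theorem iterate_extend_nil (ζ : A → List A) (k : ℕ) : (extend ζ)^[k] [] = [] :=
  Function.iterate_fixed rfl k

theorem iterate_extend_eq_flatMap (ζ : A → List A) (k : ℕ) (u : List A) :
    (extend ζ)^[k] u = u.flatMap (iter ζ k) := by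
  induction u with
  | nil => exact iterate_extend_nil ζ k
  | cons a u ih =>
    rw [List.flatMap_cons, ← ih, ← List.singleton_append, iterate_extend_append, iter]

theorem iter_power (ζ : A → List A) (s t : ℕ) (a : A) :
    iter (power ζ s) t a = iter ζ (s * t) a := by
  have : extend (power ζ s) = (extend ζ)^[s] := by
    funext u
    rw [iterate_extend_eq_flatMap]
    rfl
  rw [iter, this, iter, Function.iterate_mul]

theorem iter_add (ζ : A → List A) (m n : ℕ) (a : A) :
    iter ζ (m + n) a = (iter ζ n a).flatMap (iter ζ m) := by
  rw [iter, Function.iterate_add_apply, iterate_extend_eq_flatMap]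
  rfl

theorem length_mul_le_length_flatMap {f : A → List A} {N : ℕ} (h : ∀ a, N ≤ (f a).length)
    (u : List A) : u.length * N ≤ (u.flatMap f).length := by
  induction u with
  | nil => simp
  | cons a u ih =>
    rw [List.flatMap_cons, List.length_append, List.length_cons, add_mul, one_mul, add_comm]
    exact Nat.add_le_add (h a) ih

/-- An empty image would remain empty under all further iterations. -/
theorem IsExpanding.one_le_length {ζ : A → List A} (hζ : IsExpanding ζ) (a : A) :
    1 ≤ (ζ a).length := by
  obtain ⟨k, hk, h⟩ := hζ
  obtain ⟨k, rfl⟩ := Nat.exists_eq_add_of_le' hk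
  by_contra! h0
  have h1 : ζ a = [] := List.length_eq_zero_iff.1 (by omega)
  have h2 := h a
  rw [iter, Function.iterate_succ_apply, show extend ζ [a] = ζ a by simp [extend], h1,
    iterate_extend_nil] at h2
  simp at h2

theorem IsExpanding.length_iter_mono {ζ : A → List A} (hζ : IsExpanding ζ) (a : A) :
    Monotone fun n => (iter ζ n a).length := by
  refine monotone_nat_of_le_succ fun n => ?_
  have h := length_mul_le_length_flatMap hζ.one_le_length (iter ζ n a)
  rw [mul_one] at h
  exact h.trans_eq (by rw [iter, iter, Function.iterate_succ_apply', extend])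

theorem IsExpanding.exists_le_length_iter {ζ : A → List A} (hζ : IsExpanding ζ) (N : ℕ) :
    ∃ m₀, ∀ m, m₀ ≤ m → ∀ a, N ≤ (iter ζ m a).length := by
  obtain ⟨k, -, hk2⟩ := id hζ
  refine ⟨k * N, fun m hm a => le_trans ?_ (hζ.length_iter_mono a hm)⟩
  clear hm
  -- Each application of `ζ^k` at least doubles the length, so it adds at least one letter.
  have h : N + 1 ≤ (iter ζ (k * N) a).length := by
    induction N with
    | zero => simp [iter]
    | succ N ih =>
      rw [Nat.mul_succ, add_comm (k * N) k, iter_add]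
      have := length_mul_le_length_flatMap hk2 (iter ζ (k * N) a)
      omega
  exact (Nat.le_succ N).trans h

theorem IsExpanding.tendsto_length_iter {ζ : A → List A} (hζ : IsExpanding ζ) (a : A) :
    Tendsto (fun n => (iter ζ n a).length) atTop atTop := by
  refine tendsto_atTop.2 fun N => ?_
  obtain ⟨m₀, h⟩ := hζ.exists_le_length_iter N
  exact eventually_atTop.2 ⟨m₀, fun m hm => h m hm a⟩

theorem IsExpanding.length_iter_pos {ζ : A → List A} (hζ : IsExpanding ζ) (n : ℕ) (a : A) :
    0 < (iter ζ n a).length :=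
  lt_of_lt_of_le (by simp [iter]) (hζ.length_iter_mono a (Nat.zero_le n))

/-! ### Occurrences and frequencies of words -/

section Occ

variable [DecidableEq A]

theorem occ_cons (w : List A) (x : A) (u : List A) :
    occ w (x :: u) = occ w u + if w <+: x :: u then 1 else 0 := by
  rw [occ, occ, List.length_cons, Finset.card_filter, Finset.card_filter,
    Finset.sum_range_succ']
  simp

theorem occ_nil {w : List A} (hw : w ≠ []) : occ w [] = 0 := by
  simp [occ, hw]

theorem occ_append_ge {w : List A} (hw : w ≠ []) (u v : List A) :
    occ w u + occ w v ≤ occ w (u ++ v) := by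
  induction u with
  | nil => simp [occ_nil hw]
  | cons x u ih =>
    rw [List.cons_append, occ_cons, occ_cons]
    have : (if w <+: x :: u then 1 else 0) ≤ if w <+: x :: (u ++ v) then 1 else 0 := by
      by_cases h : w <+: x :: u
      · rw [if_pos h, if_pos]
        exact h.trans (List.prefix_append (x :: u) v)
      · rw [if_neg h]
        exact Nat.zero_le _
    omega

/-- The extra occurrences straddle the boundary: they start in `u`, within its last `w.length`
letters. -/
theorem occ_append_le (w u v : List A) :
    occ w (u ++ v) ≤ occ w u + occ w v + min u.length w.length := by
  induction u with
  | nil => simp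
  | cons x u ih =>
    rw [List.cons_append, occ_cons, occ_cons, List.length_cons]
    rcases le_or_gt w.length (u.length + 1) with h | h
    · have : w <+: x :: (u ++ v) → w <+: x :: u := fun h' =>
        List.prefix_of_prefix_length_le h' (List.prefix_append (x :: u) v) h
      have : (if w <+: x :: (u ++ v) then 1 else 0) ≤ if w <+: x :: u then 1 else 0 := by
        split_ifs <;> simp_all
      omega
    · have : (if w <+: x :: (u ++ v) then 1 else 0) ≤ 1 := by split_ifs <;> omega
      omega

theorem sum_occ_le_occ_flatMap {w : List A} (hw : w ≠ []) (f : A → List A) (u : List A) :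
    (u.map fun a => occ w (f a)).sum ≤ occ w (u.flatMap f) := by
  induction u with
  | nil => simp
  | cons a u ih =>
    rw [List.map_cons, List.sum_cons, List.flatMap_cons]
    exact (Nat.add_le_add_left ih _).trans (occ_append_ge hw _ _)

theorem occ_flatMap_le {w : List A} (hw : w ≠ []) (f : A → List A) (u : List A) :
    occ w (u.flatMap f) ≤ (u.map fun a => occ w (f a)).sum + u.length * w.length := by
  induction u with
  | nil => simp [occ_nil hw]
  | cons a u ih =>
    rw [List.map_cons, List.sum_cons, List.flatMap_cons, List.length_cons, add_mul, one_mul]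
    have := occ_append_le w (f a) (u.flatMap f)
    omega

theorem occ_eq_zero {w u : List A} (h : ¬ w <:+: u) : occ w u = 0 := by
  rw [occ, Finset.card_eq_zero, Finset.filter_eq_empty_iff]
  intro i _ hi
  exact h (hi.isInfix.trans (List.drop_suffix i u).isInfix)

variable [Fintype A]

theorem sum_map_eq_sum_count_mul (h : A → ℕ) (u : List A) :
    (u.map h).sum = ∑ a, u.count a * h a := by
  induction u with
  | nil => simp
  | cons x u ih =>
    rw [List.map_cons, List.sum_cons, ih]
    simp [List.count_cons, add_mul, Finset.sum_add_distrib, add_comm]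

theorem length_eq_sum_count (u : List A) : u.length = ∑ a, u.count a := by
  have := sum_map_eq_sum_count_mul (fun _ => 1) u
  simpa using this

theorem length_flatMap_eq_sum (f : A → List A) (u : List A) :
    (u.flatMap f).length = ∑ a, u.count a * (f a).length := by
  rw [List.length_flatMap, sum_map_eq_sum_count_mul]

/-- The incidence matrix of a substitution. -/
def incidence (ζ : A → List A) : Matrix A A ℝ := fun a b => (ζ a).count b

theorem incidence_pow (ζ : A → List A) (t : ℕ) (a b : A) :
    (incidence ζ ^ t) a b = (iter ζ t a).count b := by
  induction t generalizing a b with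
  | zero => simp [iter, Matrix.one_apply, List.count_singleton]
  | succ t ih =>
    rw [pow_succ, Matrix.mul_apply, add_comm t 1, iter_add, List.count_flatMap,
      sum_map_eq_sum_count_mul, Nat.cast_sum]
    refine Finset.sum_congr rfl fun c _ => ?_
    have : iter ζ 1 c = ζ c := by simp [iter, extend]
    rw [ih, Function.comp, this, Nat.cast_mul]
    rfl

theorem exists_tendsto_letter_frequency (ζ : A → List A) :
    ∃ s : ℕ, 1 ≤ s ∧ ∀ a b : A, ∃ c : ℝ, Tendsto (fun t : ℕ =>
      ((iter ζ (s * t) a).count b : ℝ) / (iter ζ (s * t) a).length) atTop (𝓝 c) := by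
  have h0 : ∀ a b, 0 ≤ incidence ζ a b := fun a b => Nat.cast_nonneg _
  obtain ⟨s, hs, htrans⟩ := Matrix.exists_pow_transitive (incidence ζ) h0
  refine ⟨s, hs, fun a b => ?_⟩
  obtain ⟨c, hc⟩ := Matrix.exists_tendsto_pow_div_sum (incidence ζ ^ s)
    (fun i j => by rw [incidence_pow]; exact Nat.cast_nonneg _) htrans a b
  refine ⟨c, hc.congr fun t => ?_⟩
  simp_rw [← pow_mul, incidence_pow]
  rw [length_eq_sum_count (iter ζ (s * t) a), Nat.cast_sum]

end Occ

/-- A sequence of reals which is approximated by convergent sequences converges. -/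
theorem exists_tendsto_of_approx {R : ℕ → ℝ} (h : ∀ ε > 0, ∃ q : ℕ → ℝ, ∃ L : ℝ,
    Tendsto q atTop (𝓝 L) ∧ ∀ᶠ n in atTop, |R n - q n| ≤ ε) : ∃ L, Tendsto R atTop (𝓝 L) := by
  refine cauchySeq_tendsto_of_complete (Metric.cauchySeq_iff'.2 fun ε hε => ?_)
  obtain ⟨q, L, hq, hR⟩ := h (ε / 5) (by positivity)
  have h1 : ∀ᶠ n in atTop, |q n - L| < ε / 5 := by
    simpa [Real.dist_eq] using (Metric.tendsto_nhds.1 hq) (ε / 5) (by positivity)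
  obtain ⟨N, hN⟩ := eventually_atTop.1 (hR.and h1)
  refine ⟨N, fun n hn => ?_⟩
  have h2 := hN n hn
  have h3 := hN N le_rfl
  rw [Real.dist_eq]
  simp only [abs_le, abs_lt] at *
  constructor <;> linarith [h2.1.1, h2.1.2, h2.2.1, h2.2.2, h3.1.1, h3.1.2, h3.2.1, h3.2.2]

/-- The exponent is that of the letter frequencies and serves all words. The ratio of the
occurrences of `w` inside blocks to the total length converges with the letter frequencies; at most
`w.length` occurrences per block are missed. -/
theorem exists_tendsto_frequency [Fintype A] [DecidableEq A] {ζ : A → List A}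
    (hζ : IsExpanding ζ) : ∃ s : ℕ, 1 ≤ s ∧ ∀ (a : A) (w : List A), w ≠ [] → ∃ c : ℝ,
      Tendsto (fun t : ℕ => (occ w (iter ζ (s * t) a) : ℝ) / (iter ζ (s * t) a).length)
        atTop (𝓝 c) := by
  obtain ⟨s, hs, hfreq⟩ := exists_tendsto_letter_frequency ζ
  refine ⟨s, hs, fun a w hw => exists_tendsto_of_approx fun ε hε => ?_⟩
  -- Blocks of length at least `N` keep the missed proportion below `w.length / N < ε`.
  obtain ⟨N, hN⟩ := exists_nat_gt (w.length / ε : ℝ)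
  have hN0 : (0 : ℝ) < N := lt_of_le_of_lt (by positivity) hN
  obtain ⟨m, hm⟩ := hζ.exists_le_length_iter N
  have hm' : ∀ b, N ≤ (iter ζ (s * m) b).length := fun b => hm _ (Nat.le_mul_of_pos_left m hs) b
  choose v hv using hfreq a
  set len : ℕ → ℝ := fun t => (iter ζ (s * t) a).length with hlen
  have hlen0 : ∀ t, 0 < len t := fun t => Nat.cast_pos.2 (hζ.length_iter_pos _ a)
  have hsplit : ∀ t, iter ζ (s * (t + m)) a = (iter ζ (s * t) a).flatMap (iter ζ (s * m)) := by
    intro t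
    rw [← iter_add]
    congr 1
    ring
  have hden : ∀ t, len (t + m) / len t =
      ∑ b, ((iter ζ (s * t) a).count b : ℝ) / len t * (iter ζ (s * m) b).length := by
    intro t
    have : len (t + m) =
        ∑ b, ((iter ζ (s * t) a).count b : ℝ) * (iter ζ (s * m) b).length := by
      simp only [hlen]
      rw [hsplit, length_flatMap_eq_sum]
      push_cast
      rfl
    rw [this, Finset.sum_div]
    exact Finset.sum_congr rfl fun b _ => by ring
  have hge : ∀ t, len t * N ≤ len (t + m) := by
    intro t
    simp only [hlen]
    rw [hsplit]
    exact_mod_cast length_mul_le_length_flatMap hm' _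
  have hdlim := tendsto_finsetSum (Finset.univ : Finset A) fun b _ =>
    (hv b).mul_const ((iter ζ (s * m) b).length : ℝ)
  have hnlim := tendsto_finsetSum (Finset.univ : Finset A) fun b _ =>
    (hv b).mul_const (occ w (iter ζ (s * m) b) : ℝ)
  have hdpos : (N : ℝ) ≤ ∑ b, v b * ((iter ζ (s * m) b).length : ℝ) := by
    refine ge_of_tendsto' hdlim fun t => ?_
    rw [← hden t, le_div_iff₀ (hlen0 t), mul_comm]
    exact hge t
  have hq := hnlim.div hdlim (hN0.trans_le hdpos).ne'
  refine ⟨_, _, hq.comp (tendsto_sub_atTop_nat m), ?_⟩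
  filter_upwards [eventually_ge_atTop m] with T hT
  obtain ⟨t, rfl⟩ := Nat.exists_eq_add_of_le' hT
  have hnum : (∑ b, ((iter ζ (s * t) a).count b : ℝ) / len t * occ w (iter ζ (s * m) b)) =
      (((iter ζ (s * t) a).map fun b => occ w (iter ζ (s * m) b)).sum : ℕ) / len t := by
    rw [sum_map_eq_sum_count_mul, Nat.cast_sum, Finset.sum_div]
    refine Finset.sum_congr rfl fun b _ => ?_
    push_cast
    ring
  simp only [Function.comp, Nat.add_sub_cancel, Pi.div_apply]
  have hL := hlen0 (t + m)
  have hl := hlen0 t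
  rw [← hden t, hnum, div_div_div_cancel_right₀ hl.ne', ← sub_div, abs_div, abs_of_pos hL,
    div_le_iff₀ hL]
  have h1 := sum_occ_le_occ_flatMap hw (iter ζ (s * m)) (iter ζ (s * t) a)
  have h2 := occ_flatMap_le hw (iter ζ (s * m)) (iter ζ (s * t) a)
  rw [← hsplit] at h1 h2
  have h1' : ((((iter ζ (s * t) a).map fun b => occ w (iter ζ (s * m) b)).sum : ℕ) : ℝ) ≤
      occ w (iter ζ (s * (t + m)) a) := by exact_mod_cast h1
  have h2' : (occ w (iter ζ (s * (t + m)) a) : ℝ) ≤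
      (((iter ζ (s * t) a).map fun b => occ w (iter ζ (s * m) b)).sum : ℕ) +
        len t * w.length := by
    simp only [hlen]
    rw [← Nat.cast_mul, ← Nat.cast_add]
    exact Nat.cast_le.2 h2
  rw [abs_of_nonneg (sub_nonneg.2 h1')]
  rw [div_lt_iff₀ hε] at hN
  have h3 := hge t
  nlinarith [mul_le_mul_of_nonneg_left hN.le hl.le, mul_le_mul_of_nonneg_left h3 hε.le]

/-! ### Segments, and invariant measures on the full shift and the subshift -/

/-- The biinfinite words which carry the word `w` at the position `i`. -/
def segment (i : ℤ) (w : List A) : Set (ℤ → A) := {x | factor x i w.length = w}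

theorem factor_eq_iff {x : ℤ → A} {i : ℤ} {w : List A} :
    factor x i w.length = w ↔ ∀ j : Fin w.length, x (i + (j : ℕ)) = w.get j := by
  conv_lhs => rw [← List.ofFn_get w]
  simp only [factor, List.length_ofFn]
  constructor
  · intro h j
    have := congrArg (fun l : List A => l[(j : ℕ)]?) h
    simpa using this
  · intro h
    refine List.ext_getElem (by simp) fun n h1 h2 => ?_
    simpa using h ⟨n, by simpa using h1⟩

theorem segment_eq_iInter (i : ℤ) (w : List A) :
    segment i w = ⋂ j : Fin w.length, {x | x (i + (j : ℕ)) = w.get j} := by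
  ext x
  simp only [segment, Set.mem_iInter]
  exact factor_eq_iff

theorem length_factor (x : ℤ → A) (i : ℤ) (n : ℕ) : (factor x i n).length = n := by
  simp [factor]

theorem mem_segment_factor {x y : ℤ → A} {i : ℤ} {n : ℕ} :
    x ∈ segment i (factor y i n) ↔ ∀ j : ℕ, j < n → x (i + j) = y (i + j) := by
  change factor x i (factor y i n).length = _ ↔ _
  rw [length_factor, factor, factor, List.ofFn_inj, funext_iff]
  exact ⟨fun h j hj => h ⟨j, hj⟩, fun h j => h j j.2⟩

/-- The shift of the full shift space, by an arbitrary amount. -/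
def translate (n : ℤ) (x : ℤ → A) : ℤ → A := fun i => x (i + n)

theorem factor_translate (n : ℤ) (x : ℤ → A) (i : ℤ) (m : ℕ) :
    factor (translate n x) i m = factor x (i + n) m := by
  simp only [factor, translate, add_right_comm]

theorem preimage_translate_segment (n i : ℤ) (w : List A) :
    translate n ⁻¹' segment i w = segment (i + n) w := by
  ext x
  change factor (translate n x) i w.length = w ↔ _
  rw [factor_translate]
  rfl

section Topological

variable [TopologicalSpace A]

theorem continuous_translate (n : ℤ) : Continuous (translate n : (ℤ → A) → ℤ → A) :=
  continuous_pi fun i => continuous_apply (i + n)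

theorem isClopen_segment [DiscreteTopology A] (i : ℤ) (w : List A) : IsClopen (segment i w) := by
  rw [segment_eq_iInter]
  refine isClopen_iInter_of_finite fun j => ?_
  exact (isClopen_discrete {w.get j}).preimage (continuous_apply (i + ((j : ℕ) : ℤ)))

end Topological

section Measurable

variable [MeasurableSpace A]

theorem measurable_translate (n : ℤ) : Measurable (translate n : (ℤ → A) → ℤ → A) :=
  measurable_pi_lambda _ fun i => measurable_pi_apply (i + n)

theorem measurable_shift (ζ : A → List A) : Measurable (shift ζ) :=
  ((measurable_translate 1).comp measurable_subtype_coe).subtype_mk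

variable [MeasurableSingletonClass A]

theorem measurableSet_segment (i : ℤ) (w : List A) : MeasurableSet (segment i w) := by
  rw [segment_eq_iInter]
  exact MeasurableSet.iInter fun j => measurable_pi_apply _ (measurableSet_singleton _)

theorem measure_preimage_segment {ζ : A → List A} {μ : Measure (subshift ζ)}
    (hμ : MeasurePreserving (shift ζ) μ μ) (i : ℤ) (w : List A) :
    μ (Subtype.val ⁻¹' segment i w) = μ (cylinder ζ w) := by
  have hstep : ∀ i : ℤ, μ (Subtype.val ⁻¹' segment (i + 1) w) = μ (Subtype.val ⁻¹' segment i w) := by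
    intro i
    rw [← hμ.measure_preimage
      (measurable_subtype_coe (measurableSet_segment i w)).nullMeasurableSet,
      ← preimage_translate_segment]
    rfl
  change _ = μ (Subtype.val ⁻¹' segment 1 w)
  induction i using Int.induction_on with
  | zero => exact (hstep 0).symm
  | succ i ih => rw [hstep, ih]
  | pred i ih => rw [← hstep, sub_add_cancel, ih]

variable [Finite A]

/-- Over a finite alphabet there are countably many forbidden words and positions. -/
theorem measurableSet_subshift (ζ : A → List A) : MeasurableSet (subshift ζ) := by
  have : subshift ζ = ⋂ (i : ℤ) (w : {w // w ∉ language ζ}), (segment i (w : List A))ᶜ := by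
    ext x
    simp only [Set.mem_iInter, segment]
    constructor
    · intro h i w hw
      exact w.2 (hw ▸ h i _)
    · intro h i n
      by_contra hn
      exact h i ⟨_, hn⟩ (by change factor x i (factor x i n).length = _; rw [length_factor])
  rw [this]
  exact MeasurableSet.iInter fun i => MeasurableSet.iInter fun w =>
    (measurableSet_segment i _).compl

/-- Two probability measures on the full shift which agree on all segments are equal. -/
theorem measure_ext_segment {μ ν : Measure (ℤ → A)} [IsProbabilityMeasure μ]
    [IsProbabilityMeasure ν] (h : ∀ i w, μ (segment i w) = ν (segment i w)) : μ = ν := by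
  let box : ℕ → (ℤ → A) → Set (ℤ → A) := fun N y => {x | ∀ j, |j| ≤ (N : ℤ) → x j = y j}
  have hbox : ∀ N y, box N y = segment (-N) (factor y (-N) (2 * N + 1)) := by
    intro N y
    ext x
    rw [mem_segment_factor]
    constructor
    · intro hx j hj
      exact hx _ (abs_le.2 ⟨by omega, by omega⟩)
    · intro hx j hj
      have h1 := abs_le.1 hj
      have h2 := hx (j + N).toNat (by omega)
      rwa [Int.toNat_of_nonneg (by omega), neg_add_cancel_comm_assoc] at h2
  refine ext_of_generate_finite {S | ∃ N y, S = box N y} ?_ ?_ ?_ ?_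
  · refine le_antisymm ?_ ?_
    · refine iSup_le fun j => ?_
      rw [MeasurableSpace.comap_le_iff_le_map]
      intro T _
      change MeasurableSet[MeasurableSpace.generateFrom _] ((fun x : ℤ → A => x j) ⁻¹' T)
      -- A window has finitely many fillings, so a condition on the coordinate `j` is a finite union
      -- of centered boxes.
      let r : (ℤ → A) → (Set.Icc (-|j|) |j| → A) := fun x k => x k
      have hr : ∀ f, MeasurableSet[MeasurableSpace.generateFrom {S | ∃ N y, S = box N y}]
          (r ⁻¹' {f}) := by
        intro f
        rcases (r ⁻¹' {f}).eq_empty_or_nonempty with h0 | ⟨y, hy⟩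
        · rw [h0]
          exact MeasurableSpace.measurableSet_empty _
        · refine MeasurableSpace.measurableSet_generateFrom ⟨j.natAbs, y, ?_⟩
          have hy' : r y = f := hy
          ext x
          change r x = f ↔ ∀ k : ℤ, |k| ≤ (j.natAbs : ℤ) → x k = y k
          rw [← hy', funext_iff, Int.natCast_natAbs]
          exact ⟨fun hx k hk => hx ⟨k, abs_le.1 hk⟩, fun hx k => hx k (abs_le.2 k.2)⟩
      have hj : j ∈ Set.Icc (-|j|) |j| := ⟨neg_abs_le j, le_abs_self j⟩
      have hT : (fun x : ℤ → A => x j) ⁻¹' T =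
          ⋃ f : {f : Set.Icc (-|j|) |j| → A // f ⟨j, hj⟩ ∈ T}, r ⁻¹' {f.1} := by
        ext x
        simp only [Set.mem_iUnion, Set.mem_preimage, Set.mem_singleton_iff]
        constructor
        · intro hx
          exact ⟨⟨r x, hx⟩, rfl⟩
        · rintro ⟨f, hf⟩
          have := f.2
          rwa [← hf] at this
      rw [hT]
      exact MeasurableSet.iUnion fun f => hr _
    · refine MeasurableSpace.generateFrom_le ?_
      rintro S ⟨N, y, rfl⟩
      rw [hbox]
      exact measurableSet_segment _ _
  -- Centered boxes are nested or disjoint, so they form a π-system; general segments would not.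
  · have key : ∀ N y M z, N ≤ M → (box N y ∩ box M z).Nonempty → box N y ∩ box M z = box M z := by
      rintro N y M z hNM ⟨x, hx1, hx2⟩
      refine Set.inter_eq_right.2 fun x' hx' j hj => ?_
      have hj' : |j| ≤ (M : ℤ) := hj.trans (by exact_mod_cast hNM)
      rw [hx' j hj', ← hx2 j hj', hx1 j hj]
    rintro S ⟨N, y, rfl⟩ T ⟨M, z, rfl⟩ hne
    rcases le_total N M with hNM | hNM
    · exact ⟨M, z, key _ _ _ _ hNM hne⟩
    · rw [Set.inter_comm] at hne ⊢
      exact ⟨N, y, key _ _ _ _ hNM hne⟩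
  · rintro S ⟨N, y, rfl⟩
    rw [hbox]
    exact h _ _
  · rw [measure_univ, measure_univ]

/-- Invariance moves cylinders to every position, and the empty word is covered by total mass `1`;
the comparison takes place on the full shift. -/
theorem measure_ext_cylinder {ζ : A → List A} {μ ν : Measure (subshift ζ)}
    [IsProbabilityMeasure μ] [IsProbabilityMeasure ν] (hμ : MeasurePreserving (shift ζ) μ μ)
    (hν : MeasurePreserving (shift ζ) ν ν)
    (h : ∀ w : List A, w ≠ [] → μ.real (cylinder ζ w) = ν.real (cylinder ζ w)) : μ = ν := by
  refine (MeasurableEmbedding.subtype_coe (measurableSet_subshift ζ)).map_injective ?_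
  have := Measure.isProbabilityMeasure_map (μ := μ)
    (measurable_subtype_coe (p := (· ∈ subshift ζ))).aemeasurable
  have := Measure.isProbabilityMeasure_map (μ := ν)
    (measurable_subtype_coe (p := (· ∈ subshift ζ))).aemeasurable
  refine measure_ext_segment fun i w => ?_
  rw [Measure.map_apply measurable_subtype_coe (measurableSet_segment i w),
    Measure.map_apply measurable_subtype_coe (measurableSet_segment i w),
    measure_preimage_segment hμ, measure_preimage_segment hν]
  rcases eq_or_ne w [] with rfl | hw
  · have : cylinder ζ [] = Set.univ := by
      ext x
      simp [cylinder, factor]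
    rw [this, measure_univ, measure_univ]
  · exact (measureReal_eq_measureReal_iff).1 (h w hw)

/-- A shift-invariant probability measure on the full shift which vanishes on the words outside
the language comes from one on the subshift. -/
theorem exists_measure_subshift {ζ : A → List A} {ν : Measure (ℤ → A)} [IsProbabilityMeasure ν]
    (hν : ν.map (translate 1) = ν) (h0 : ∀ w ∉ language ζ, ν (segment 1 w) = 0) :
    ∃ μ : Measure (subshift ζ), IsProbabilityMeasure μ ∧ MeasurePreserving (shift ζ) μ μ ∧
      ∀ w, μ (cylinder ζ w) = ν (segment 1 w) := by
  have hemb := MeasurableEmbedding.subtype_coe (measurableSet_subshift ζ)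
  have hpos : ∀ (i : ℤ) w, ν (segment i w) = ν (segment 1 w) := by
    intro i w
    have hstep : ∀ i : ℤ, ν (segment (i + 1) w) = ν (segment i w) := by
      intro i
      conv_rhs => rw [← hν, Measure.map_apply (measurable_translate 1) (measurableSet_segment i w)]
      rw [preimage_translate_segment]
    induction i using Int.induction_on with
    | zero => exact (hstep 0).symm
    | succ i ih => rw [hstep, ih]
    | pred i ih => rw [← hstep, sub_add_cancel, ih]
  have hnull : ν (subshift ζ)ᶜ = 0 := by
    refine measure_mono_null (t := ⋃ (i : ℤ) (w : {w // w ∉ language ζ}), segment i (w : List A)) ?_ ?_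
    · intro x hx
      obtain ⟨i, n, hin⟩ : ∃ i n, factor x i n ∉ language ζ := by
        by_contra! hc
        exact hx hc
      exact Set.mem_iUnion.2 ⟨i, Set.mem_iUnion.2 ⟨⟨_, hin⟩, mem_segment_factor.2 fun _ _ => rfl⟩⟩
    · exact measure_iUnion_null fun i => measure_iUnion_null fun w => (hpos i _).trans (h0 _ w.2)
  have hmap : (ν.comap (Subtype.val : subshift ζ → ℤ → A)).map Subtype.val = ν := by
    rw [hemb.map_comap, Subtype.range_coe, Measure.restrict_eq_self_of_ae_mem]
    exact hnull
  refine ⟨ν.comap Subtype.val, ⟨?_⟩, ⟨measurable_shift ζ, hemb.map_injective ?_⟩, fun w => ?_⟩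
  · rw [← Set.preimage_univ (f := (Subtype.val : subshift ζ → ℤ → A)),
      ← Measure.map_apply measurable_subtype_coe MeasurableSet.univ, hmap, measure_univ]
  · rw [Measure.map_map measurable_subtype_coe (measurable_shift ζ), hmap]
    change Measure.map (translate 1 ∘ Subtype.val) _ = _
    rw [← Measure.map_map (measurable_translate 1) measurable_subtype_coe, hmap, hν]
  · change (ν.comap Subtype.val) (Subtype.val ⁻¹' segment 1 w) = _
    rw [← Measure.map_apply measurable_subtype_coe (measurableSet_segment 1 w), hmap]

end Measurable

/-! ### Empirical measures and their weak limits -/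

/-- A biinfinite word which carries the finite word `u` at the position `1`. -/
def embed (d : A) (u : List A) : ℤ → A := fun i => u.getD (i - 1).toNat d

theorem factor_embed (d : A) (u : List A) {j n : ℕ} (h : j + n ≤ u.length) :
    factor (embed d u) (1 + j) n = (u.drop j).take n := by
  refine List.ext_getElem (by simp [factor]; omega) fun k h1 h2 => ?_
  have hk : k < n := by simpa [factor] using h1
  have : (1 + (j : ℤ) + k - 1).toNat = j + k := by omega
  simp only [factor, embed, List.getElem_ofFn, this, List.getElem_take, List.getElem_drop]
  exact List.getD_eq_getElem _ d (by omega)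

section Empirical

variable [MeasurableSpace A]

/-- The empirical measure of the first `L` translates of a biinfinite word. -/
noncomputable def empirical (x : ℤ → A) (L : ℕ) : Measure (ℤ → A) :=
  (L : ENNReal)⁻¹ • ∑ j ∈ Finset.range L, Measure.dirac (translate j x)

theorem isProbabilityMeasure_empirical (x : ℤ → A) {L : ℕ} (hL : 0 < L) :
    IsProbabilityMeasure (empirical x L) := by
  refine ⟨?_⟩
  rw [empirical, Measure.smul_apply, Measure.finsetSum_apply]
  simp only [measure_univ, Finset.sum_const, Finset.card_range, nsmul_eq_mul, mul_one, smul_eq_mul]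
  exact ENNReal.inv_mul_cancel (by exact_mod_cast hL.ne') (ENNReal.natCast_ne_top L)

theorem empirical_real (x : ℤ → A) (L : ℕ) {S : Set (ℤ → A)} (hS : MeasurableSet S) :
    (empirical x L).real S = (∑ j ∈ Finset.range L, S.indicator 1 (translate j x)) / (L : ℝ) := by
  rw [Measure.real, empirical, Measure.smul_apply, Measure.finsetSum_apply, smul_eq_mul,
    ENNReal.toReal_mul, ENNReal.toReal_inv, ENNReal.toReal_natCast, ENNReal.toReal_sum
      fun j _ => measure_ne_top _ _, div_eq_inv_mul]
  congr 1
  refine Finset.sum_congr rfl fun j _ => ?_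
  rw [Measure.dirac_apply' _ hS]
  by_cases h : translate j x ∈ S <;> simp [h]

/-- The difference of the two sums telescopes to two indicator values. -/
theorem abs_empirical_preimage_sub_le (x : ℤ → A) {L : ℕ} (hL : 0 < L) {S : Set (ℤ → A)}
    (hS : MeasurableSet S) :
    |(empirical x L).real (translate 1 ⁻¹' S) - (empirical x L).real S| ≤ 1 / L := by
  have hL' : (0 : ℝ) < L := by exact_mod_cast hL
  rw [empirical_real x L hS, empirical_real x L (measurable_translate 1 hS), ← sub_div, abs_div,
    abs_of_pos hL']
  refine div_le_div_of_nonneg_right ?_ hL'.le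
  have h1 : ∀ j : ℕ, (translate 1 ⁻¹' S).indicator (1 : (ℤ → A) → ℝ) (translate j x) =
      S.indicator 1 (translate ((j + 1 : ℕ) : ℤ) x) := by
    intro j
    have : translate 1 (translate (j : ℤ) x) = translate ((j + 1 : ℕ) : ℤ) x := by
      funext i
      simp only [translate]
      congr 1
      push_cast
      ring
    rw [← this]
    rfl
  simp_rw [h1]
  rw [← Finset.sum_sub_distrib,
    Finset.sum_range_sub (fun j : ℕ => S.indicator (1 : (ℤ → A) → ℝ) (translate (j : ℤ) x))]
  have h2 : ∀ z, S.indicator (1 : (ℤ → A) → ℝ) z = 0 ∨ S.indicator (1 : (ℤ → A) → ℝ) z = 1 := by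
    intro z
    by_cases h : z ∈ S <;> simp [h]
  rcases h2 (translate (L : ℤ) x) with h | h <;> rcases h2 (translate ((0 : ℕ) : ℤ) x) with h' | h' <;>
    rw [h, h'] <;> norm_num

theorem abs_empirical_segment_sub_le [DecidableEq A] [MeasurableSingletonClass A] (d : A)
    {u w : List A} (hu : 0 < u.length) (hw : w ≠ []) :
    |(empirical (embed d u) u.length).real (segment 1 w) - (occ w u : ℝ) / u.length| ≤
      (w.length : ℝ) / u.length := by
  classical
  have hL' : (0 : ℝ) < u.length := by exact_mod_cast hu
  rw [empirical_real _ _ (measurableSet_segment 1 w), ← sub_div, abs_div, abs_of_pos hL']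
  refine div_le_div_of_nonneg_right ?_ hL'.le
  set F : Finset ℕ := (Finset.range u.length).filter
    fun j => translate (j : ℤ) (embed d u) ∈ segment 1 w with hF
  set F' : Finset ℕ := (Finset.range (u.length + 1)).filter fun i => w <+: u.drop i with hF'
  have hmem : ∀ j : ℕ, translate (j : ℤ) (embed d u) ∈ segment 1 w ↔
      factor (embed d u) (1 + j) w.length = w := by
    intro j
    rw [← factor_translate]
    rfl
  have hsum : ∑ j ∈ Finset.range u.length,
      (segment 1 w).indicator (1 : (ℤ → A) → ℝ) (translate (j : ℤ) (embed d u)) = F.card := by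
    rw [hF, Finset.card_filter]
    push_cast
    exact Finset.sum_congr rfl fun j _ => by simp [Set.indicator_apply]
  have hw0 : 0 < w.length := List.length_pos_iff.2 hw
  have hiff : ∀ j, j + w.length ≤ u.length →
      (factor (embed d u) (1 + j) w.length = w ↔ w <+: u.drop j) := by
    intro j hj
    rw [factor_embed d u hj, List.prefix_iff_eq_take, eq_comm]
  have h1 : F' ⊆ F := by
    intro j hj
    obtain ⟨hj1, hj2⟩ := Finset.mem_filter.1 hj
    have hlen := hj2.length_le
    rw [List.length_drop] at hlen
    refine Finset.mem_filter.2 ⟨Finset.mem_range.2 (by omega), (hmem j).2 ?_⟩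
    exact (hiff j (by omega)).2 hj2
  -- Only windows starting within the last `w.length` positions can leave `u` and see the padding of
  -- `embed`.
  have h2 : F ⊆ F' ∪ Finset.Ico (u.length - w.length) u.length := by
    intro j hj
    obtain ⟨hj1, hj2⟩ := Finset.mem_filter.1 hj
    rw [Finset.mem_range] at hj1
    rw [Finset.mem_union]
    by_cases hlen : j + w.length ≤ u.length
    · left
      exact Finset.mem_filter.2 ⟨Finset.mem_range.2 (by omega),
        (hiff j hlen).1 ((hmem j).1 hj2)⟩
    · right
      exact Finset.mem_Ico.2 ⟨by omega, hj1⟩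
  have h3 := Finset.card_le_card h1
  have h4 := (Finset.card_le_card h2).trans (Finset.card_union_le _ _)
  rw [Nat.card_Ico] at h4
  have h3' : (occ w u : ℝ) ≤ F.card := by exact_mod_cast h3
  have h4' : (F.card : ℝ) ≤ occ w u + w.length := by
    have : F.card ≤ occ w u + w.length := h4.trans (Nat.add_le_add_left (by omega) _)
    exact_mod_cast this
  rw [hsum, abs_le]
  constructor <;> linarith

end Empirical

/-- If the frequencies of all words converge along a sequence of words of the language whose
lengths tend to infinity, then the limits define an invariant measure on the subshift. -/
theorem exists_measure_of_tendsto_frequency [Fintype A] [DecidableEq A]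
    [TopologicalSpace A] [DiscreteTopology A] [MeasurableSpace A] [BorelSpace A]
    {ζ : A → List A} {u : ℕ → List A} (hu : ∀ t, u t ∈ language ζ) (hpos : ∀ t, 0 < (u t).length)
    (hlen : Tendsto (fun t => (u t).length) atTop atTop) {c : List A → ℝ}
    (hc : ∀ w ≠ [], Tendsto (fun t => (occ w (u t) : ℝ) / (u t).length) atTop (𝓝 (c w))) :
    ∃ μ : Measure (subshift ζ), IsProbabilityMeasure μ ∧ MeasurePreserving (shift ζ) μ μ ∧
      ∀ w ≠ [], μ.real (cylinder ζ w) = c w := by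
  obtain ⟨d⟩ : Nonempty A := ⟨(u 0)[0]'(hpos 0)⟩
  let E : ℕ → ProbabilityMeasure (ℤ → A) := fun t =>
    ⟨empirical (embed d (u t)) (u t).length, isProbabilityMeasure_empirical _ (hpos t)⟩
  let U : Ultrafilter ℕ := hyperfilter ℕ
  have hU : (U : Filter ℕ) ≤ atTop := Nat.hyperfilter_le_atTop
  -- The probability measures on the compact space `ℤ → A` form a compact space; the ultrafilter
  -- replaces a convergent subsequence.
  obtain ⟨ν, -, hν⟩ := isCompact_univ.ultrafilter_le_nhds (U.map E) (by simp)
  have hν' : Tendsto E U (𝓝 ν) := hν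
  have hclopen : ∀ S : Set (ℤ → A), IsClopen S →
      Tendsto (fun t => (empirical (embed d (u t)) (u t).length).real S) U
        (𝓝 ((ν : Measure (ℤ → A)).real S)) := by
    intro S hS
    have := ProbabilityMeasure.tendsto_measure_of_isClopen_of_tendsto hν' hS
    exact (NNReal.continuous_coe.tendsto _).comp this
  have hinv : ∀ k : ℝ, Tendsto (fun t => k / ((u t).length : ℝ)) U (𝓝 0) := fun k =>
    ((tendsto_natCast_atTop_atTop.comp hlen).const_div_atTop k).mono_left hU
  have hseg : ∀ w ≠ [], (ν : Measure (ℤ → A)).real (segment 1 w) = c w := by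
    intro w hw
    refine tendsto_nhds_unique (hclopen _ (isClopen_segment 1 w)) ?_
    have h1 := squeeze_zero_norm
      (f := fun t => (empirical (embed d (u t)) (u t).length).real (segment 1 w) -
        (occ w (u t) : ℝ) / (u t).length)
      (fun t => abs_empirical_segment_sub_le d (hpos t) hw) (hinv w.length)
    have h2 := h1.add ((hc w hw).mono_left hU)
    rw [zero_add] at h2
    exact h2.congr fun t => sub_add_cancel _ _
  have hshift : ∀ i w, (ν : Measure (ℤ → A)).real (translate 1 ⁻¹' segment i w) =
      (ν : Measure (ℤ → A)).real (segment i w) := by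
    intro i w
    have hS := isClopen_segment i w
    have h1 := hclopen _ (hS.preimage (continuous_translate 1))
    have h2 := squeeze_zero_norm
      (f := fun t => (empirical (embed d (u t)) (u t).length).real (translate 1 ⁻¹' segment i w) -
        (empirical (embed d (u t)) (u t).length).real (segment i w))
      (fun t => abs_empirical_preimage_sub_le (embed d (u t)) (hpos t)
      (measurableSet_segment i w)) (hinv 1)
    exact sub_eq_zero.1 (tendsto_nhds_unique (h1.sub (hclopen _ hS)) h2)
  have hmap : (ν : Measure (ℤ → A)).map (translate 1) = ν := by
    have := Measure.isProbabilityMeasure_map (μ := (ν : Measure (ℤ → A)))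
      (measurable_translate (A := A) 1).aemeasurable
    refine measure_ext_segment fun i w => ?_
    rw [Measure.map_apply (measurable_translate 1) (measurableSet_segment i w)]
    exact (measureReal_eq_measureReal_iff).1 (hshift i w)
  -- A word outside the language never occurs in the words `u t`, so its frequency limit is `0`.
  have hnull : ∀ w ∉ language ζ, (ν : Measure (ℤ → A)) (segment 1 w) = 0 := by
    intro w hw
    have hw' : w ≠ [] := by
      rintro rfl
      obtain ⟨a, k, -⟩ := hu 0
      exact hw ⟨a, k, List.nil_infix⟩
    have hocc : ∀ t, occ w (u t) = 0 := fun t => occ_eq_zero fun h => by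
      obtain ⟨a, k, hk⟩ := hu t
      exact hw ⟨a, k, h.trans hk⟩
    have h0 := hc w hw'
    simp only [hocc, Nat.cast_zero, zero_div] at h0
    have h4 := hseg w hw'
    rw [← tendsto_nhds_unique tendsto_const_nhds h0] at h4
    rwa [measureReal_eq_zero_iff] at h4
  obtain ⟨μ, h1, h2, h3⟩ := exists_measure_subshift hmap hnull
  refine ⟨μ, h1, h2, fun w hw => ?_⟩
  rw [Measure.real, h3, ← hseg w hw, Measure.real]

end Subst

/-! ### Existence and uniqueness of the family -/

theorem corollary1p3 {A : Type*} [Fintype A] [DecidableEq A]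
    [TopologicalSpace A] [DiscreteTopology A] [MeasurableSpace A] [BorelSpace A]
    (ζ : A → List A) (hζ : Subst.IsExpanding ζ) :
    ∃! μ : A → Measure (Subst.subshift ζ),
      (∀ a : A, IsProbabilityMeasure (μ a) ∧
        MeasurePreserving (Subst.shift ζ) (μ a) (μ a)) ∧
      ∃ s : ℕ, 1 ≤ s ∧ ∀ (a : A) (w : List A), w ≠ [] →
        Tendsto
          (fun t : ℕ => (Subst.occ w (Subst.iter (Subst.power ζ s) t a) : ℝ) /
            ((Subst.iter (Subst.power ζ s) t a).length : ℝ))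
          atTop (𝓝 ((μ a).real (Subst.cylinder ζ w))) := by
  simp_rw [Subst.iter_power]
  obtain ⟨s, hs, hfreq⟩ := Subst.exists_tendsto_frequency hζ
  have hmul : ∀ {r : ℕ}, 1 ≤ r → Tendsto (fun t => r * t) atTop atTop := fun hr =>
    tendsto_id.const_mul_atTop' hr
  have hex : ∀ a, ∃ μ : Measure (Subst.subshift ζ), IsProbabilityMeasure μ ∧
      MeasurePreserving (Subst.shift ζ) μ μ ∧ ∀ w : List A, w ≠ [] →
        Tendsto (fun t : ℕ => (Subst.occ w (Subst.iter ζ (s * t) a) : ℝ) /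
          ((Subst.iter ζ (s * t) a).length : ℝ)) atTop (𝓝 (μ.real (Subst.cylinder ζ w))) := by
    intro a
    choose! c hc using hfreq a
    obtain ⟨μ, h1, h2, h3⟩ := Subst.exists_measure_of_tendsto_frequency (ζ := ζ)
      (u := fun t => Subst.iter ζ (s * t) a) (fun t => ⟨a, s * t, List.infix_rfl⟩)
      (fun t => hζ.length_iter_pos _ a) ((hζ.tendsto_length_iter a).comp (hmul hs)) hc
    exact ⟨μ, h1, h2, fun w hw => by rw [h3 w hw]; exact hc w hw⟩
  choose μ h1 h2 h3 using hex
  refine ⟨μ, ⟨fun a => ⟨h1 a, h2 a⟩, s, hs, h3⟩, ?_⟩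
  rintro μ' ⟨hμ', s', hs', h'⟩
  funext a
  have := h1 a
  have := (hμ' a).1
  refine Subst.measure_ext_cylinder (hμ' a).2 (h2 a) fun w hw => ?_
  -- Both limits are taken along the common subsequence of exponents `s * s' * t`.
  refine tendsto_nhds_unique ((h' a w hw).comp (hmul hs)) ?_
  refine ((h3 a w hw).comp (hmul hs')).congr fun t => ?_
  simp only [Function.comp, ← mul_assoc, mul_comm s s']
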